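/- Let $(\Omega,\mathcal F,\mathbb P)$ be a complete probability space carrying a one-dimensional standard Brownian motion $B$, and let $(\mathcal F_t)_{t\ge0}$ be its augmented filtration. Fix $\mu,r\in\mathbb R$ and $\sigma,\tau,\gamma,\delta>0$, $\alpha\in(0,1)$, $k\ge0$ such that $\phi:=\frac{\mu-r}{\sigma}\neq0$ and $\delta>h:=r\alpha+\frac{\alpha\phi^2}{2(1-\alpha)}$. Put $Z_\tau:=\exp\big(-\phi B_\tau-(r+\tfrac{\phi^2}{2})\tau\big)$, $U(x):=x^\alpha$ for $x\ge0$ and $U(x):=-k|x|^\alpha$ for $x<0$, and $F(y;\theta):=U(y-\gamma)+\theta y^\alpha$. Let $\mathcal Y$ be the set of $\mathcal F_\tau$-measurable random variables $Y\ge0$ with $\mathbb E[Z_\tau Y]\le1$, and let $\Phi(\theta):=\sup_{Y\in\mathcal Y}\mathbb E[F(Y;\theta)]$. For $\kappa\in[0,1]$ let $\theta^*(\kappa)$ be the unique real number with $\theta^*(\kappa)=e^{-\delta\tau}\Phi(\kappa\theta^*(\kappa))$. Define $$A_{\mathrm{my}}:=\theta^*(0)=e^{-\delta\tau}\sup_{Y\in\mathcal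 Y}\mathbb E[U(Y-\gamma)],\qquad A_{\mathrm{expo}}:=\theta^*(1).$$ For $\beta\in(0,1]$ and $\xi\in[0,e^{h\tau}]$ let $\kappa_\beta(\xi):=\dfrac{\beta}{1-(1-\beta)e^{-\delta\tau}\xi}\in(0,1]$, $\Theta_\beta(\xi):=\kappa_\beta(\xi)\,\theta^*(\kappa_\beta(\xi))$, and $$G_\beta(\xi):=\Big\{\mathbb E[Y^\alpha]\;:\;Y\in\operatorname*{arg\,max}_{Y\in\mathcal Y}\mathbb E\big[F(Y;\Theta_\beta(\xi))\big]\Big\}.$$ A fixed point of $G_\beta$ is a $\hat\xi\in[0,e^{h\tau}]$ with $\hat\xi\in G_\beta(\hat\xi)$; given a choice $\hat\xi$ of such a fixed point, put $A_{\mathrm{so}}(\beta):=\Theta_\beta(\hat\xi)$. 1. If $A_{\mathrm{my}}>0$, then $\beta\mapsto\beta A_{\mathrm{expo}}$ is non-decreasing on $(0,1]$, and $\beta\mapsto A_{\mathrm{so}}(\beta)$ is non-decreasing on the set of those $\beta\in(0,1]$ for which $G_\beta$ has a unique fixed point (so on all of $(0,1]$ if the fixed point is unique for every $\beta$). 2.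 If $A_{\mathrm{my}}<0$, then $\beta\mapsto\beta A_{\mathrm{expo}}$ is non-increasing on $(0,1]$; moreover, for every $\beta\in(0,1]$ the map $G_\beta$ has a fixed point, and $A_{\mathrm{so}}$ is non-increasing on $(0,1]$: if $0<\beta_1\le\beta_2\le1$ and $\hat\xi_1,\hat\xi_2$ are any fixed points of $G_{\beta_1},G_{\beta_2}$, then $\Theta_{\beta_2}(\hat\xi_2)\le\Theta_{\beta_1}(\hat\xi_1)$ (in particular $A_{\mathrm{so}}(\beta)$ does not depend on the choice of the fixed point). -/

import Mathlib

open MeasureTheory ProbabilityTheory Set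
open scoped NNReal ENNReal

namespace PeriodicPortfolio

/-- The parameters of the model, apart from the myopia level `β`: the Black-Scholes market
(`mu`, `r`, `sigma`), the length `τ` of an evaluation period, the benchmark `γ`, the utility
parameters `α` and `k`, and the discount rate `δ`, with the standing assumptions on them. -/
structure Model where
  mu : ℝ
  r : ℝ
  sigma : ℝ
  τ : ℝ
  γ : ℝ
  α : ℝ
  k : ℝ
  δ : ℝ
  sigma_pos : 0 < sigma
  sharpe_ne_zero : (mu - r) / sigma ≠ 0
  τ_pos : 0 < τ
  γ_pos : 0 < γ
  α_pos : 0 < α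
  α_lt_one : α < 1
  k_nonneg : 0 ≤ k
  δ_pos : 0 < δ
  /-- The well-posedness assumption `δ > h` (see `Model.h`). -/
  well_posed : r * α + α * ((mu - r) / sigma) ^ 2 / (2 * (1 - α)) < δ

namespace Model

/-- The Sharpe ratio `φ = (μ - r) / σ`. -/
noncomputable def sharpe (M : Model) : ℝ := (M.mu - M.r) / M.sigma

/-- The constant `h = r α + α φ² / (2 (1 - α))`. -/
noncomputable def h (M : Model) : ℝ :=
  M.r * M.α + M.α * M.sharpe ^ 2 / (2 * (1 - M.α))

/-- The one-period discount factor `e^{-δ τ}`. -/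
noncomputable def disc (M : Model) : ℝ := Real.exp (-(M.δ * M.τ))

/-- The piecewise power utility: `x ^ α` for `x ≥ 0` and `-k |x| ^ α` for `x < 0`. -/
noncomputable def U (M : Model) (x : ℝ) : ℝ :=
  if 0 ≤ x then x ^ M.α else -M.k * |x| ^ M.α

/-- `F(y; θ) = U(y - γ) + θ y ^ α`. -/
noncomputable def F (M : Model) (y θ : ℝ) : ℝ := M.U (y - M.γ) + θ * y ^ M.α

/-- The weight `κ = β / (1 - (1 - β) e^{-δ τ} ξ)`. -/
noncomputable def weight (M : Model) (β ξ : ℝ) : ℝ := β / (1 - (1 - β) * M.disc * ξ)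

end Model

section

variable {Ω : Type*} [MeasurableSpace Ω]

/-- The σ-algebra of the augmented Brownian filtration at time `t`: generated by the increments
`B s - B 0` for `s ≤ t` and by the `P`-null sets. -/
@[reducible] def augmentedSigma (P : Measure Ω) (B : ℝ≥0 → Ω → ℝ) (t : ℝ≥0) : MeasurableSpace Ω :=
  eventuallyMeasurableSpace
    (⨆ s : Iic t, MeasurableSpace.comap (fun ω => B s ω - B 0 ω) inferInstance) (ae P)

/-- The pricing kernel `Z_t = exp(-φ B_t - (r + φ² / 2) t)`. -/
noncomputable def pricingKernel (M : Model) (B : ℝ≥0 → Ω → ℝ) (t : ℝ≥0) (ω : Ω) : ℝ :=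
  Real.exp (-M.sharpe * B t ω - (M.r + M.sharpe ^ 2 / 2) * t)

/-- The set `𝒴` of attainable gross returns over one period: nonnegative, `ℱ_τ`-measurable random
variables with `E[Z_τ Y] ≤ 1`. -/
def returns (M : Model) (P : Measure Ω) (B : ℝ≥0 → Ω → ℝ) : Set (Ω → ℝ) :=
  {Y | Measurable[augmentedSigma P B M.τ.toNNReal] Y ∧ (∀ᵐ ω ∂P, 0 ≤ Y ω) ∧
    ∫⁻ ω, ENNReal.ofReal (pricingKernel M B M.τ.toNNReal ω * Y ω) ∂P ≤ 1}

/-- `E[F(Y; θ)]`. For `Y ∈ 𝒴` the integrand is integrable, since `E[Y ^ α] ≤ e^{h τ}`. -/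
noncomputable def objective (M : Model) (P : Measure Ω) (θ : ℝ) (Y : Ω → ℝ) : ℝ :=
  ∫ ω, M.F (Y ω) θ ∂P

/-- `Φ(θ) = sup_{Y ∈ 𝒴} E[F(Y; θ)]`. -/
noncomputable def Phi (M : Model) (P : Measure Ω) (B : ℝ≥0 → Ω → ℝ) (θ : ℝ) : ℝ :=
  sSup (objective M P θ '' returns M P B)

/-- `θ*(κ)`, for `κ ∈ [0, 1]`: the fixed point of the contraction `θ ↦ e^{-δ τ} Φ(κ θ)`. -/
noncomputable def thetaStar (M : Model) (P : Measure Ω) (B : ℝ≥0 → Ω → ℝ) (κ : ℝ) : ℝ :=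
  Classical.epsilon fun θ => θ = M.disc * Phi M P B (κ * θ)

/-- The value `A_my = e^{-δ τ} sup_{Y ∈ 𝒴} E[U(Y - γ)]` of the completely myopic agent. -/
noncomputable def AMy (M : Model) (P : Measure Ω) (B : ℝ≥0 → Ω → ℝ) : ℝ :=
  M.disc * sSup ((fun Y : Ω → ℝ => ∫ ω, M.U (Y ω - M.γ) ∂P) '' returns M P B)

/-- The value `A_expo = θ*(1)` of the exponential discounter. -/
noncomputable def AExpo (M : Model) (P : Measure Ω) (B : ℝ≥0 → Ω → ℝ) : ℝ :=
  thetaStar M P B 1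

/-- `argmax_{Y ∈ 𝒴} E[F(Y; θ)]`. -/
def maximizers (M : Model) (P : Measure Ω) (B : ℝ≥0 → Ω → ℝ) (θ : ℝ) : Set (Ω → ℝ) :=
  {Y | Y ∈ returns M P B ∧ IsMaxOn (objective M P θ) (returns M P B) Y}

/-- `κ θ*(κ)` with `κ = β / (1 - (1 - β) e^{-δ τ} ξ)`. -/
noncomputable def Theta (M : Model) (P : Measure Ω) (B : ℝ≥0 → Ω → ℝ) (β ξ : ℝ) : ℝ :=
  M.weight β ξ * thetaStar M P B (M.weight β ξ)

/-- The set-valued map `G(ξ) = {E[Y ^ α] : Y ∈ argmax_{Y ∈ 𝒴} E[F(Y; κ θ*(κ))]}` at level `β`. -/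
noncomputable def G (M : Model) (P : Measure Ω) (B : ℝ≥0 → Ω → ℝ) (β ξ : ℝ) : Set ℝ :=
  (fun Y : Ω → ℝ => ∫ ω, (Y ω) ^ M.α ∂P) '' maximizers M P B (Theta M P B β ξ)

/-- The fixed points of `G` on its domain `[0, e^{h τ}]`. -/
def fixedPointsG (M : Model) (P : Measure Ω) (B : ℝ≥0 → Ω → ℝ) (β : ℝ) : Set ℝ :=
  {ξ | ξ ∈ Icc 0 (Real.exp (M.h * M.τ)) ∧ ξ ∈ G M P B β ξ}

/-- The constant `A_so(β) = κ θ*(κ)`, `κ = β / (1 - (1 - β) e^{-δ τ} ξ)`, of the sophisticated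
agent, for the chosen fixed point `ξ` of `G`. -/
noncomputable def ASo (M : Model) (P : Measure Ω) (B : ℝ≥0 → Ω → ℝ) (β ξ : ℝ) : ℝ :=
  Theta M P B β ξ

end

end PeriodicPortfolio

/-!
The value function `Φ` is a supremum of affine functions of `θ` with slopes `E[Y ^ α]`, and Hölder's
inequality bounds these slopes by `K = e^{h τ}`. So `Φ` is convex and `K`-Lipschitz, with
`ρ K < 1` for `ρ = e^{-δ τ}`, and the `α`-moment of a maximizer is a subgradient of `Φ`. Conversely,
every subgradient is attained by a maximizer. By Lagrangian duality, a maximizer buys, state by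
state, the quantity demanded at a multiple `c` of the state price. If the budget binds, demand is
a.s. unique because the state price has no atoms, so `Φ` is differentiable. If not, the maximizers
take values in the satiation points of `F(·; θ)`, and perturbing `θ` to the right, with the
multiplier `(θ' - θ) μ`, selects among them by the demand at the price `μ Z` of an agent with
utility `y ^ α`; varying `μ` sweeps out all the subgradients.

A fixed point `ξ` of `G` with constant `θ = A_so` is therefore a subgradient `ξ` of `Φ` at `θ` with
`θ (1 - (1 - β) ρ ξ) = β ρ Φ(θ)`. The graph of the subdifferential of `Φ` is connected, so this
equation is solved by the intermediate value theorem. Writing `V = θ / β`, it says that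
`V = ρ (Φ(θ) + ξ (V - θ))`, the value at `V` of a tangent line; since tangents have slope at most
`K` and `ρ K < 1`, comparing two tangents compares the values `V`, hence the constants `θ`.
-/

namespace PeriodicPortfolio

open Filter Topology

section Subgradient

variable {f : ℝ → ℝ} {K : ℝ≥0} {θ ξ θ' ξ' : ℝ}

/-- `ξ` is a subgradient of `f` at `θ`: the line of slope `ξ` through `(θ, f θ)` stays below the
graph of `f`. -/
def IsSubgradient (f : ℝ → ℝ) (θ ξ : ℝ) : Prop := ∀ θ', f θ + ξ * (θ' - θ) ≤ f θ'

lemma IsSubgradient.mul_sub_nonneg (h : IsSubgradient f θ ξ) (h' : IsSubgradient f θ' ξ') :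
    0 ≤ (ξ - ξ') * (θ - θ') := by
  linarith [h θ', h' θ]

lemma IsSubgradient.le_of_lt (h : IsSubgradient f θ ξ) (h' : IsSubgradient f θ' ξ')
    (hlt : θ < θ') : ξ ≤ ξ' := by
  by_contra! hξ
  nlinarith [h.mul_sub_nonneg h']

lemma le_add_mul_abs_of_lipschitzWith (hL : LipschitzWith K f) (a b : ℝ) :
    f b ≤ f a + K * |b - a| := by
  have h := hL.dist_le_mul b a
  rw [Real.dist_eq, Real.dist_eq] at h
  linarith [le_abs_self (f b - f a)]

lemma IsSubgradient.le (h : IsSubgradient f θ ξ) (hL : LipschitzWith K f) : ξ ≤ K := by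
  have h1 := le_add_mul_abs_of_lipschitzWith hL θ (θ + 1)
  rw [add_sub_cancel_left, abs_one] at h1
  linarith [h (θ + 1)]

lemma IsSubgradient.le_of_tendsto {m : ℝ → ℝ} {m₀ : ℝ} (h : IsSubgradient f θ ξ)
    (hm : Tendsto m (𝓝[>] θ) (𝓝 m₀))
    (hle : ∀ᶠ x in 𝓝[>] θ, f x ≤ f θ + m x * (x - θ)) : ξ ≤ m₀ := by
  refine ge_of_tendsto hm ?_
  filter_upwards [hle, self_mem_nhdsWithin] with x hx hθx
  exact le_of_mul_le_mul_right (by linarith [h x]) (sub_pos.2 hθx)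

lemma IsSubgradient.ge_of_tendsto {m : ℝ → ℝ} {m₀ : ℝ} (h : IsSubgradient f θ ξ)
    (hm : Tendsto m (𝓝[<] θ) (𝓝 m₀))
    (hle : ∀ᶠ x in 𝓝[<] θ, f x ≤ f θ + m x * (x - θ)) : m₀ ≤ ξ := by
  refine _root_.le_of_tendsto hm ?_
  filter_upwards [hle, self_mem_nhdsWithin] with x hx hxθ
  exact le_of_mul_le_mul_right (by linarith [h x]) (sub_pos.2 hxθ)

lemma isSubgradient_of_forall_le (hf : ConvexOn ℝ univ f) {x : ℝ}
    (hmin : ∀ y, f θ + (θ - x) ^ 2 / 2 ≤ f y + (y - x) ^ 2 / 2) :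
    IsSubgradient f θ (x - θ) := by
  intro y
  set d := y - θ with hd
  have key : ∀ t ∈ Ioo (0 : ℝ) 1, (x - θ) * d - t * d ^ 2 / 2 ≤ f y - f θ := by
    rintro t ⟨ht0, ht1⟩
    have hmin_t := hmin (θ + t * d)
    have hconv_t := hf.2 (mem_univ θ) (mem_univ y) (by linarith : 0 ≤ 1 - t) ht0.le (by ring)
    rw [show (1 - t) • θ + t • y = θ + t * d by simp only [smul_eq_mul, hd]; ring] at hconv_t
    simp only [smul_eq_mul] at hconv_t
    exact le_of_mul_le_mul_left (by nlinarith) ht0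
  have hlim : Tendsto (fun t : ℝ => (x - θ) * d - t * d ^ 2 / 2) (𝓝[>] 0)
      (𝓝 ((x - θ) * d - 0 * d ^ 2 / 2)) :=
    (Continuous.tendsto (by fun_prop) 0).mono_left nhdsWithin_le_nhds
  have := _root_.le_of_tendsto hlim (by
    filter_upwards [Ioo_mem_nhdsGT (zero_lt_one (α := ℝ))] with t ht using key t ht)
  linarith

lemma exists_isSubgradient_sub (hf : ConvexOn ℝ univ f) (hL : LipschitzWith K f) (x : ℝ) :
    ∃ θ, IsSubgradient f θ (x - θ) := by
  have hcont := hL.continuous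
  have hfar : ∀ᶠ y in cocompact ℝ, f x + (x - x) ^ 2 / 2 ≤ f y + (y - x) ^ 2 / 2 := by
    filter_upwards [(isCompact_closedBall x (2 * K)).compl_mem_cocompact] with y hy
    rw [mem_compl_iff, Metric.mem_closedBall, Real.dist_eq, not_le] at hy
    have h := le_add_mul_abs_of_lipschitzWith hL y x
    rw [abs_sub_comm] at h
    nlinarith [sq_abs (y - x), abs_nonneg (y - x)]
  obtain ⟨θ, hθ⟩ := Continuous.exists_forall_le'
    (f := fun y => f y + (y - x) ^ 2 / 2) (by fun_prop) x hfar
  exact ⟨θ, isSubgradient_of_forall_le hf hθ⟩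

/-- Minty's parametrization of the graph of the subdifferential by the sum of the two
coordinates. -/
lemma exists_continuous_parametrization (hf : ConvexOn ℝ univ f) (hL : LipschitzWith K f) :
    ∃ θ : ℝ → ℝ, Continuous θ ∧ Monotone θ ∧ (∀ x, IsSubgradient f (θ x) (x - θ x)) ∧
      ∀ a ξ, IsSubgradient f a ξ → θ (a + ξ) = a := by
  choose θ hθ using exists_isSubgradient_sub hf hL
  have hcontr : ∀ x y, (θ x - θ y) ^ 2 ≤ (x - y) * (θ x - θ y) := fun x y => by
    linarith [(hθ x).mul_sub_nonneg (hθ y)]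
  refine ⟨θ, ?_, fun x y hxy => ?_, hθ, fun a ξ h => ?_⟩
  · refine (LipschitzWith.of_dist_le_mul (K := 1) fun x y => ?_).continuous
    rw [NNReal.coe_one, one_mul, Real.dist_eq, Real.dist_eq]
    have h : |θ x - θ y| ^ 2 ≤ |x - y| * |θ x - θ y| := by
      rw [sq_abs, ← abs_mul]
      exact (hcontr x y).trans (le_abs_self _)
    by_contra! hlt
    nlinarith [abs_nonneg (x - y)]
  · by_contra! hlt
    nlinarith [hcontr y x]
  · have h := (hθ (a + ξ)).mul_sub_nonneg h
    have hsq : (θ (a + ξ) - a) ^ 2 = 0 := le_antisymm (by linarith) (sq_nonneg _)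
    linarith [pow_eq_zero_iff two_ne_zero |>.1 hsq]

lemma exists_isSubgradient (hf : ConvexOn ℝ univ f) (θ : ℝ) : ∃ ξ, IsSubgradient f θ ξ := by
  have hθ : θ ∈ interior univ := by simp
  refine ⟨derivWithin f (Ioi θ) θ, fun y => ?_⟩
  rcases lt_trichotomy y θ with hy | rfl | hy
  · have h := (hf.slope_le_leftDeriv_of_mem_interior (mem_univ y) hθ hy).trans
      (hf.leftDeriv_le_rightDeriv_of_mem_interior hθ)
    rw [slope_def_field, div_le_iff₀ (sub_pos.2 hy)] at h
    linarith
  · simp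
  · have h := hf.rightDeriv_le_slope_of_mem_interior hθ (mem_univ y) hy
    rw [slope_def_field, le_div_iff₀ (sub_pos.2 hy)] at h
    linarith

/-- The graph of the subdifferential is connected, so the intermediate value theorem holds along
it. -/
lemma exists_isSubgradient_eq_zero (hf : ConvexOn ℝ univ f) (hL : LipschitzWith K f)
    {E : ℝ → ℝ → ℝ} (hE : Continuous fun q : ℝ × ℝ => E q.1 q.2) {a b ξa ξb : ℝ}
    (ha : IsSubgradient f a ξa) (hb : IsSubgradient f b ξb) (hab : a ≤ b)
    (hEa : 0 ≤ E a ξa) (hEb : E b ξb ≤ 0) :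
    ∃ θ ξ, IsSubgradient f θ ξ ∧ θ ∈ Icc a b ∧ E θ ξ = 0 := by
  obtain ⟨θ, hθ, hmono, hsub, hθ_eq⟩ := exists_continuous_parametrization hf hL
  have hcont : Continuous fun x => E (θ x) (x - θ x) :=
    hE.comp (hθ.prodMk (continuous_id.sub hθ))
  obtain ⟨x, hx, hx0⟩ := intermediate_value_uIcc (a := a + ξa) (b := b + ξb) hcont.continuousOn
    (show (0 : ℝ) ∈ _ by
      simp only [hθ_eq _ _ ha, hθ_eq _ _ hb, add_sub_cancel_left]
      exact mem_uIcc_of_ge hEb hEa)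
  refine ⟨θ x, x - θ x, hsub x, ?_, hx0⟩
  rcases mem_uIcc.1 hx with ⟨h1, h2⟩ | ⟨h1, h2⟩
  · exact ⟨hθ_eq _ _ ha ▸ hmono h1, hθ_eq _ _ hb ▸ hmono h2⟩
  · have h3 := hθ_eq _ _ ha ▸ hmono h2
    have h4 := hθ_eq _ _ hb ▸ hmono h1
    exact ⟨hab.trans h4, h3.trans hab⟩

end Subgradient

section Equilibrium

variable {f : ℝ → ℝ} {K : ℝ≥0} {ρ β β₁ β₂ θ θ₁ θ₂ ξ ξ₁ ξ₂ κ : ℝ}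

/-- `θ` is an equilibrium constant at the myopia level `β` for the one-period value function `f`
and the discount factor `ρ`, supported by the subgradient `ξ`. The equation says that `V = θ / β`
satisfies `V = ρ (f θ + ξ (V - θ))`, i.e. that `V` is the value, discounted exponentially, of the
stationary policy which is optimal in every period for the continuation constant `θ = β V`. -/
structure IsEquilibrium (f : ℝ → ℝ) (ρ β θ ξ : ℝ) : Prop where
  isSubgradient : IsSubgradient f θ ξ
  eq : θ * (1 - (1 - β) * ρ * ξ) = β * ρ * f θ

lemma IsEquilibrium.div_eq (h : IsEquilibrium f ρ β θ ξ) (hβ : β ≠ 0) :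
    θ / β = ρ * (f θ + ξ * (θ / β - θ)) := by
  have := h.eq
  field_simp
  linarith

lemma IsSubgradient.mul_lt_one (h : IsSubgradient f θ ξ) (hL : LipschitzWith K f) (hρ : 0 ≤ ρ)
    (hρK : ρ * K < 1) : ρ * ξ < 1 :=
  (mul_le_mul_of_nonneg_left (h.le hL) hρ).trans_lt hρK

lemma exists_isEquilibrium_mem_Icc (hf : ConvexOn ℝ univ f) (hL : LipschitzWith K f)
    (h₁ : IsSubgradient f θ₁ ξ₁) (h₂ : IsSubgradient f θ₂ ξ₂) (hle : θ₁ ≤ θ₂)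
    (hθ₁ : θ₁ * (1 - (1 - β) * ρ * ξ₁) ≤ β * ρ * f θ₁)
    (hθ₂ : β * ρ * f θ₂ ≤ θ₂ * (1 - (1 - β) * ρ * ξ₂)) :
    ∃ θ ξ, IsEquilibrium f ρ β θ ξ ∧ θ ∈ Icc θ₁ θ₂ := by
  have hcont := hL.continuous
  obtain ⟨θ, ξ, h, hθ, hE⟩ := exists_isSubgradient_eq_zero hf hL
    (E := fun θ ξ => β * ρ * f θ - θ * (1 - (1 - β) * ρ * ξ)) (by fun_prop) h₁ h₂ hle
    (sub_nonneg.2 hθ₁) (sub_nonpos.2 hθ₂)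
  exact ⟨θ, ξ, ⟨h, (sub_eq_zero.1 hE).symm⟩, hθ⟩

lemma exists_isEquilibrium_of_neg (hf : ConvexOn ℝ univ f) (hL : LipschitzWith K f)
    (hρ : 0 < ρ) (hρK : ρ * K < 1) (hβ : β ∈ Ioc (0 : ℝ) 1) (h0 : f 0 < 0) :
    ∃ θ ξ, IsEquilibrium f ρ β θ ξ := by
  -- the fixed point of `θ ↦ ρ (f 0 + K θ)`, which minorizes `θ ↦ ρ (f θ)` on `θ ≤ 0`
  set a := ρ * f 0 / (1 - ρ * K) with ha
  have ha0 : a < 0 := div_neg_of_neg_of_pos (mul_neg_of_pos_of_neg hρ h0) (by linarith)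
  have ha_eq : a = ρ * (f 0 + K * a) := by
    rw [ha]
    field_simp [(by linarith : 1 - ρ * K ≠ 0)]
    ring
  obtain ⟨ξa, hξa⟩ := exists_isSubgradient hf a
  obtain ⟨ξ₀, hξ₀⟩ := exists_isSubgradient hf 0
  have hfa : a ≤ ρ * f a := by
    have h := le_add_mul_abs_of_lipschitzWith hL a 0
    rw [zero_sub, abs_neg, abs_of_neg ha0] at h
    linarith [mul_le_mul_of_nonneg_left h hρ.le]
  have hEa : a * (1 - (1 - β) * ρ * ξa) ≤ β * ρ * f a := by
    have hρξ := hξa.mul_lt_one hL hρ.le hρK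
    have hβle : β ≤ 1 - (1 - β) * ρ * ξa := by
      linarith [mul_nonneg (sub_nonneg.2 hβ.2) (sub_nonneg.2 hρξ.le)]
    linarith [mul_le_mul_of_nonpos_left hβle ha0.le, mul_le_mul_of_nonneg_left hfa hβ.1.le]
  obtain ⟨θ, ξ, h, -⟩ := exists_isEquilibrium_mem_Icc hf hL hξa hξ₀ ha0.le hEa
    (by simpa using (mul_neg_of_pos_of_neg (mul_pos hβ.1 hρ) h0).le)
  exact ⟨θ, ξ, h⟩

lemma IsEquilibrium.le_of_neg (h₁ : IsEquilibrium f ρ β₁ θ₁ ξ₁) (h₂ : IsEquilibrium f ρ β₂ θ₂ ξ₂)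
    (hL : LipschitzWith K f) (hρ : 0 ≤ ρ) (hρK : ρ * K < 1) (hβ₁ : β₁ ∈ Ioc (0 : ℝ) 1)
    (hβ : β₁ ≤ β₂) (hθ₂ : θ₂ < 0) : θ₂ ≤ θ₁ := by
  by_contra! hlt
  have hβ₂ : 0 < β₂ := hβ₁.1.trans_le hβ
  obtain ⟨V₁, rfl⟩ : ∃ V₁, θ₁ = β₁ * V₁ := ⟨θ₁ / β₁, by field_simp [hβ₁.1.ne']⟩
  obtain ⟨V₂, rfl⟩ : ∃ V₂, θ₂ = β₂ * V₂ := ⟨θ₂ / β₂, by field_simp⟩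
  have hV₁_eq := h₁.div_eq hβ₁.1.ne'
  have hV₂_eq := h₂.div_eq hβ₂.ne'
  rw [mul_div_cancel_left₀ _ hβ₁.1.ne'] at hV₁_eq
  rw [mul_div_cancel_left₀ _ hβ₂.ne'] at hV₂_eq
  have hV₂ : V₂ < 0 := by nlinarith
  have hV₁ : V₁ < 0 := by nlinarith [hβ₁.1]
  have hV₁_le : V₁ ≤ β₁ * V₁ := by nlinarith [hβ₁.2]
  -- left of `θ₁` the tangent at `θ₂` lies below the tangent at `θ₁`
  have htangent : f (β₂ * V₂) + ξ₂ * (V₁ - β₂ * V₂) ≤ f (β₁ * V₁) + ξ₁ * (V₁ - β₁ * V₁) := by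
    have hξ := h₁.isSubgradient.le_of_lt h₂.isSubgradient hlt
    linarith [h₂.isSubgradient (β₁ * V₁),
      mul_nonneg (sub_nonneg.2 hξ) (sub_nonneg.2 hV₁_le)]
  have hV : V₂ ≤ V₁ := by
    have h := mul_le_mul_of_nonneg_left htangent hρ
    have hρξ := h₂.isSubgradient.mul_lt_one hL hρ hρK
    have : 0 ≤ (1 - ρ * ξ₂) * (V₁ - V₂) := by linarith
    linarith [nonneg_of_mul_nonneg_right this (by linarith)]
  have : β₂ * V₂ ≤ β₁ * V₁ :=
    (mul_le_mul_of_nonpos_right hβ hV₂.le).trans (mul_le_mul_of_nonneg_left hV hβ₁.1.le)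
  exact hlt.not_ge this

lemma IsEquilibrium.exists_le_of_pos (h₂ : IsEquilibrium f ρ β₂ θ₂ ξ₂) (hf : ConvexOn ℝ univ f)
    (hL : LipschitzWith K f) (hρ : 0 ≤ ρ) (hρK : ρ * K < 1) (hβ₁ : 0 ≤ β₁) (hβ₂ : 0 < β₂)
    (hβ : β₁ ≤ β₂) (h0 : 0 ≤ f 0) (hθ₂ : 0 ≤ θ₂) :
    ∃ θ₁ ξ₁, IsEquilibrium f ρ β₁ θ₁ ξ₁ ∧ θ₁ ∈ Icc 0 θ₂ := by
  obtain ⟨ξ₀, hξ₀⟩ := exists_isSubgradient hf 0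
  have hintercept : 0 ≤ ρ * (f θ₂ - ξ₂ * θ₂) := by
    have hρξ := h₂.isSubgradient.mul_lt_one hL hρ hρK
    have hV := h₂.div_eq hβ₂.ne'
    have : 0 ≤ (1 - ρ * ξ₂) * (θ₂ / β₂) := mul_nonneg (by linarith) (by positivity)
    linarith
  exact exists_isEquilibrium_mem_Icc hf hL hξ₀ h₂.isSubgradient hθ₂
    (by rw [zero_mul]; positivity)
    (by linarith [h₂.eq, mul_nonneg (sub_nonneg.2 hβ) hintercept])

lemma contractingWith_mul_comp (hL : LipschitzWith K f) (hρ : 0 ≤ ρ) (hρK : ρ * K < 1)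
    (hκ : κ ∈ Icc (0 : ℝ) 1) :
    ContractingWith (ρ * K).toNNReal fun θ => ρ * f (κ * θ) := by
  refine ⟨by rwa [Real.toNNReal_lt_one], LipschitzWith.of_dist_le_mul fun a b => ?_⟩
  have h := hL.dist_le_mul (κ * a) (κ * b)
  rw [Real.coe_toNNReal _ (by positivity)]
  simp only [Real.dist_eq, ← mul_sub, abs_mul, abs_of_nonneg hρ, abs_of_nonneg hκ.1] at h ⊢
  calc ρ * |f (κ * a) - f (κ * b)| ≤ ρ * (K * (κ * |a - b|)) := by gcongr
    _ ≤ ρ * (K * (1 * |a - b|)) := by gcongr; exact hκ.2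
    _ = ρ * K * |a - b| := by ring

lemma mul_pos_of_eq_mul_comp (hL : LipschitzWith K f) (hρ : 0 < ρ) (hρK : ρ * K < 1)
    (hκ : κ ∈ Icc (0 : ℝ) 1) (hθ : θ = ρ * f (κ * θ)) (h0 : f 0 ≠ 0) : 0 < θ * f 0 := by
  have hne : θ ≠ 0 := by
    rintro rfl
    simp [hρ.ne', h0] at hθ
  have hc := contractingWith_mul_comp hL hρ.le hρK hκ
  have hdist : |θ - ρ * f 0| ≤ (ρ * K).toNNReal * |θ| := by
    simpa [← hθ, Real.dist_eq] using hc.toLipschitzWith.dist_le_mul θ 0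
  have hsq : (θ - ρ * f 0) ^ 2 < θ ^ 2 :=
    sq_lt_sq.2 (hdist.trans_lt (mul_lt_of_lt_one_left (abs_pos.2 hne) hc.1))
  have : 0 < ρ * (θ * f 0) := by linarith [sq_nonneg (ρ * f 0)]
  exact pos_of_mul_pos_right this hρ.le

end Equilibrium

section Demand

variable {S : Set ℝ} {g : ℝ → ℝ} {p p' y y' : ℝ}

/-- The demand correspondence of the utility `g` on the consumption set `S`: the quantities in `S`
that maximize `g y - p y`, at the price `p`. -/
def demandSet (S : Set ℝ) (g : ℝ → ℝ) (p : ℝ) : Set ℝ :=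
  {y | y ∈ S ∧ ∀ y' ∈ S, g y' - p * y' ≤ g y - p * y}

/-- The demand function selects the least quantity demanded at the price `p` (the junk value `0` if
the demand set is empty). -/
noncomputable def demand (S : Set ℝ) (g : ℝ → ℝ) (p : ℝ) : ℝ := sInf (demandSet S g p)

lemma le_of_mem_demandSet_of_lt (hp : p < p') (hy : y ∈ demandSet S g p)
    (hy' : y' ∈ demandSet S g p') : y' ≤ y := by
  have h := hy.2 y' hy'.1
  have h' := hy'.2 y hy.1
  nlinarith

lemma isClosed_demandSet (hS : IsClosed S) (hg : Continuous g) : IsClosed (demandSet S g p) := by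
  have : demandSet S g p = S ∩ ⋂ y' ∈ S, {y | g y' - p * y' ≤ g y - p * y} := by
    ext y
    simp [demandSet]
  rw [this]
  exact hS.inter (isClosed_biInter fun y' _ => isClosed_le continuous_const (by fun_prop))

lemma demandSet_nonempty_of_forall_le (hS : IsClosed S) (hS0 : S ⊆ Ici 0) (hg : Continuous g)
    {y₀ R : ℝ} (hy₀ : y₀ ∈ S) (hR : ∀ y ∈ S, g y₀ - p * y₀ ≤ g y - p * y → y ≤ R) :
    (demandSet S g p).Nonempty := by
  have hcompact : IsCompact (S ∩ Icc 0 R) := isCompact_Icc.inter_left hS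
  have hy₀R : y₀ ∈ S ∩ Icc 0 R := ⟨hy₀, hS0 hy₀, hR y₀ hy₀ le_rfl⟩
  obtain ⟨y, hy, hmax⟩ := hcompact.exists_isMaxOn ⟨y₀, hy₀R⟩
    (f := fun y => g y - p * y) (by fun_prop)
  refine ⟨y, hy.1, fun y' hy' => ?_⟩
  rcases le_total (g y' - p * y') (g y₀ - p * y₀) with h | h
  · exact h.trans (hmax hy₀R)
  · exact hmax ⟨hy', hS0 hy', hR y' hy' h⟩

lemma demand_mem_demandSet (hS : IsClosed S) (hS0 : S ⊆ Ici 0) (hg : Continuous g)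
    (hne : (demandSet S g p).Nonempty) : demand S g p ∈ demandSet S g p :=
  (isClosed_demandSet hS hg).csInf_mem hne ⟨0, fun _ hy => hS0 hy.1⟩

lemma demand_le (hS0 : S ⊆ Ici 0) (hy : y ∈ demandSet S g p) : demand S g p ≤ y :=
  csInf_le ⟨0, fun _ hy => hS0 hy.1⟩ hy

lemma antitoneOn_demand (hd : ∀ p, 0 < p → demand S g p ∈ demandSet S g p) :
    AntitoneOn (demand S g) (Ioi 0) := by
  intro p hp p' hp' h
  rcases h.eq_or_lt with rfl | h
  · rfl
  · exact le_of_mem_demandSet_of_lt h (hd p hp) (hd p' hp')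

/-- Any other quantity demanded at `p` makes the demand function jump at `p`. -/
lemma countable_not_subset_singleton_demandSet (hS0 : S ⊆ Ici 0)
    (hd : ∀ p, 0 < p → demand S g p ∈ demandSet S g p) :
    {p | p ∈ Ioi 0 ∧ ¬ demandSet S g p ⊆ {demand S g p}}.Countable := by
  refine Countable.mono (fun p hp => ?_) (antitoneOn_demand hd).countable_not_continuousWithinAt
  refine ⟨hp.1, fun hc => hp.2 fun y hy => le_antisymm ?_ (demand_le hS0 hy)⟩
  have hc' : Tendsto (demand S g) (𝓝[<] p) (𝓝 (demand S g p)) :=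
    (hc.continuousAt (Ioi_mem_nhds hp.1)).tendsto.mono_left nhdsWithin_le_nhds
  refine _root_.ge_of_tendsto hc' ?_
  filter_upwards [self_mem_nhdsWithin, nhdsWithin_le_nhds (Ioi_mem_nhds hp.1)] with p' hp' hp'0
  exact le_of_mem_demandSet_of_lt hp' (hd p' hp'0) hy

lemma mem_demandSet_of_tendsto {ι : Type*} {l : Filter ι} [l.NeBot] {G : ℝ → ℝ → ℝ}
    (hS : IsClosed S) (hG : Continuous fun q : ℝ × ℝ => G q.1 q.2) {p θ y : ι → ℝ} {p₀ θ₀ y₀ : ℝ}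
    (hp : Tendsto p l (𝓝 p₀)) (hθ : Tendsto θ l (𝓝 θ₀)) (hy : Tendsto y l (𝓝 y₀))
    (h : ∀ᶠ i in l, y i ∈ demandSet S (fun z => G z (θ i)) (p i)) :
    y₀ ∈ demandSet S (fun z => G z θ₀) p₀ := by
  have hlim : ∀ {z : ι → ℝ} {z₀ : ℝ}, Tendsto z l (𝓝 z₀) →
      Tendsto (fun i => G (z i) (θ i) - p i * z i) l (𝓝 (G z₀ θ₀ - p₀ * z₀)) := fun hz =>
    ((hG.tendsto (_, _)).comp (hz.prodMk_nhds hθ)).sub (hp.mul hz)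
  refine ⟨hS.mem_of_tendsto hy (h.mono fun i hi => hi.1), fun y' hy' => ?_⟩
  exact le_of_tendsto_of_tendsto (hlim tendsto_const_nhds) (hlim hy)
    (h.mono fun i hi => hi.2 y' hy')

lemma tendsto_of_forall_ultrafilter {ι : Type*} {l : Filter ι} {y : ι → ℝ} {a b y₀ : ℝ}
    (hy : ∀ᶠ i in l, y i ∈ Icc a b)
    (huniq : ∀ (u : Ultrafilter ι) (z : ℝ), ↑u ≤ l → Tendsto y u (𝓝 z) → z = y₀) :
    Tendsto y l (𝓝 y₀) := by
  refine isCompact_Icc.tendsto_nhds_of_unique_mapClusterPt hy fun z _ hclus => ?_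
  obtain ⟨u, hu, hyu⟩ := mapClusterPt_iff_ultrafilter.1 hclus
  exact huniq u z hu hyu

lemma tendsto_of_mem_demandSet_of_subset_singleton {ι : Type*} {l : Filter ι} {G : ℝ → ℝ → ℝ}
    (hS : IsClosed S) (hG : Continuous fun q : ℝ × ℝ => G q.1 q.2) {p θ y : ι → ℝ}
    {p₀ θ₀ y₀ a b : ℝ} (hp : Tendsto p l (𝓝 p₀)) (hθ : Tendsto θ l (𝓝 θ₀))
    (hy : ∀ᶠ i in l, y i ∈ Icc a b) (h : ∀ᶠ i in l, y i ∈ demandSet S (fun z => G z (θ i)) (p i))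
    (huniq : demandSet S (fun z => G z θ₀) p₀ ⊆ {y₀}) : Tendsto y l (𝓝 y₀) :=
  tendsto_of_forall_ultrafilter hy fun _ _ hu hlim => huniq <|
    mem_demandSet_of_tendsto hS hG (hp.mono_left hu) (hθ.mono_left hu) hlim (h.filter_mono hu)

lemma tendsto_demand_atTop {R y₀ : ℝ} (hS : IsClosed S) (hSR : S ⊆ Icc 0 R) (hg : Continuous g)
    (hy₀ : IsLeast S y₀) : Tendsto (demand S g) atTop (𝓝 y₀) := by
  obtain ⟨C, hC⟩ := (isCompact_Icc.of_isClosed_subset hS hSR).bddAbove_image hg.continuousOn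
  have hmem : ∀ p, demand S g p ∈ demandSet S g p := fun p =>
    demand_mem_demandSet hS (hSR.trans Icc_subset_Ici_self) hg <|
      demandSet_nonempty_of_forall_le hS (hSR.trans Icc_subset_Ici_self) hg hy₀.1
        fun y hy _ => (hSR hy).2
  have hupper : Tendsto (fun p => y₀ + (C - g y₀) / p) atTop (𝓝 y₀) := by
    simpa using (tendsto_const_nhds.div_atTop tendsto_id).const_add y₀
  refine tendsto_of_tendsto_of_tendsto_of_le_of_le' tendsto_const_nhds hupper
    (Eventually.of_forall fun p => hy₀.2 (hmem p).1) ?_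
  filter_upwards [eventually_gt_atTop 0] with p hp
  have hmax := (hmem p).2 y₀ hy₀.1
  have hle : g (demand S g p) ≤ C := hC (mem_image_of_mem g (hmem p).1)
  rw [← sub_le_iff_le_add', le_div_iff₀ hp]
  linarith

end Demand

section GrowthBound

variable {α A p y : ℝ}

/-- The a priori bound on demand at the price `p`: a quantity `y` with `p y ≤ A (1 + y ^ α)` is at
most `growthBound α (2 A / p)`. The two terms handle `y ≤ 1` and `y ≥ 1`. -/
noncomputable def growthBound (α x : ℝ) : ℝ := x + x ^ (1 / (1 - α))

lemma le_growthBound (hα : α ∈ Ioo (0 : ℝ) 1) (hA : 0 ≤ A) (hp : 0 < p) (hy : 0 ≤ y)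
    (h : p * y ≤ A * (1 + y ^ α)) : y ≤ growthBound α (2 * A / p) := by
  have hα1 : 0 < 1 - α := sub_pos.2 hα.2
  have hx : 0 ≤ 2 * A / p := by positivity
  rcases le_total y 1 with hy1 | hy1
  · have hyx : y ≤ 2 * A / p := by
      rw [le_div_iff₀ hp]
      linarith [mul_le_mul_of_nonneg_left (Real.rpow_le_one hy hy1 hα.1.le) hA]
    linarith [Real.rpow_nonneg hx (1 / (1 - α)), growthBound.eq_1 α (2 * A / p)]
  · have hy0 : 0 < y := by linarith
    have hle : y ^ (1 - α) ≤ 2 * A / p := by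
      rw [Real.rpow_sub hy0, Real.rpow_one, div_le_div_iff₀ (by positivity) hp]
      linarith [mul_le_mul_of_nonneg_left (Real.one_le_rpow hy1 hα.1.le) hA]
    calc y = (y ^ (1 - α)) ^ (1 / (1 - α)) := by
          rw [← Real.rpow_mul hy, mul_one_div_cancel hα1.ne', Real.rpow_one]
      _ ≤ (2 * A / p) ^ (1 / (1 - α)) := by gcongr
      _ ≤ growthBound α (2 * A / p) := le_add_of_nonneg_left hx

lemma tendsto_growthBound_div_atTop (hα : α < 1) (a : ℝ) :
    Tendsto (fun p => growthBound α (a / p)) atTop (𝓝 0) := by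
  have : 0 < 1 - α := sub_pos.2 hα
  have hdiv : Tendsto (fun p : ℝ => a / p) atTop (𝓝 0) := tendsto_const_nhds.div_atTop tendsto_id
  simpa only [growthBound, Real.zero_rpow (by positivity : 1 / (1 - α) ≠ 0), add_zero] using
    hdiv.add (hdiv.rpow_const (p := 1 / (1 - α)) (Or.inr (by positivity)))

end GrowthBound

lemma exists_eq_or_forall_lt_or_forall_gt {f : ℝ → ℝ} (hf : ContinuousOn f (Ioi 0)) (a : ℝ) :
    (∃ c, 0 < c ∧ f c = a) ∨ (∀ c, 0 < c → f c < a) ∨ ∀ c, 0 < c → a < f c := by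
  by_contra! h
  obtain ⟨hne, ⟨c, hc, hca⟩, c', hc', hca'⟩ := h
  obtain ⟨x, hx, hxa⟩ := isPreconnected_Ioi.intermediate_value hc' hc hf ⟨hca', hca⟩
  exact hne x hx hxa

lemma tendsto_mul_const_nhdsGT_zero {z : ℝ} (hz : 0 < z) :
    Tendsto (fun c => c * z) (𝓝[>] 0) (𝓝[>] 0) := by
  simpa only [mul_comm] using tendsto_iff_comap.2 (comap_mulLeft_nhdsGT_zero hz).ge

section StatePrice

variable {Ω : Type*} {D : ℝ → ℝ} {Z : Ω → ℝ} {L : ℝ}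

lemma measurable_comp_of_antitoneOn {_ : MeasurableSpace Ω} (hD : AntitoneOn D (Ioi 0))
    (hZ : Measurable Z) (hZ0 : ∀ ω, 0 < Z ω) : Measurable fun ω => D (Z ω) := by
  have hanti : Antitone fun x => D (Real.exp x) := fun x y h =>
    hD (Real.exp_pos x) (Real.exp_pos y) (Real.exp_le_exp.2 h)
  simpa [Function.comp_def, Real.exp_log, hZ0] using hanti.measurable.comp hZ.log

lemma rpow_le_one_add {α y : ℝ} (hα : α ∈ Icc (0 : ℝ) 1) (hy : 0 ≤ y) : y ^ α ≤ 1 + y := by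
  rcases le_total y 1 with hy1 | hy1
  · linarith [Real.rpow_le_one hy hy1 hα.1]
  · linarith [Real.rpow_le_self_of_one_le hy1 hα.2]

/-- The state price densities for which the optimal investment problem is regular: positive, without
atoms, and with power moments of all orders. -/
structure IsStatePrice [MeasurableSpace Ω] (P : Measure Ω) (Z : Ω → ℝ) : Prop where
  measurable : Measurable Z
  pos : ∀ ω, 0 < Z ω
  integrable_rpow : ∀ q : ℝ, Integrable (fun ω => Z ω ^ q) P
  ae_ne : ∀ z, ∀ᵐ ω ∂P, Z ω ≠ z

variable [MeasurableSpace Ω] {P : Measure Ω} {w : Ω → ℝ} {α a c : ℝ}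

namespace IsStatePrice

lemma integrable (hZ : IsStatePrice P Z) : Integrable Z P := by
  simpa using hZ.integrable_rpow 1

lemma ae_mul_notMem (hZ : IsStatePrice P Z) {T : Set ℝ} (hT : T.Countable) (hc : c ≠ 0) :
    ∀ᵐ ω ∂P, c * Z ω ∉ T := by
  have h : ∀ᵐ ω ∂P, ∀ t ∈ T, Z ω ≠ t / c := (ae_ball_iff hT).2 fun t _ => hZ.ae_ne (t / c)
  filter_upwards [h] with ω hω hmem
  exact hω _ hmem (by field_simp)

lemma continuousOn_integral_mul_comp (hZ : IsStatePrice P Z) (hD : AntitoneOn D (Ioi 0))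
    (hD0 : ∀ p, 0 < p → 0 ≤ D p) (hw : ∀ ω, 0 ≤ w ω)
    (hint : ∀ c, 0 < c → Integrable (fun ω => w ω * D (c * Z ω)) P) :
    ContinuousOn (fun c => ∫ ω, w ω * D (c * Z ω) ∂P) (Ioi 0) := by
  intro c₀ (hc₀ : 0 < c₀)
  refine continuousWithinAt_of_dominated (bound := fun ω => w ω * D (c₀ / 2 * Z ω)) ?_ ?_
    (hint _ (half_pos hc₀)) ?_
  · filter_upwards [self_mem_nhdsWithin] with c hc using (hint c hc).aestronglyMeasurable
  · filter_upwards [self_mem_nhdsWithin, nhdsWithin_le_nhds (Ioi_mem_nhds (half_lt_self hc₀))]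
      with c (hc : 0 < c) (hc' : c₀ / 2 < c)
    refine Eventually.of_forall fun ω => ?_
    have hz := hZ.pos ω
    rw [Real.norm_of_nonneg (mul_nonneg (hw ω) (hD0 _ (by positivity)))]
    refine mul_le_mul_of_nonneg_left (hD ?_ ?_ (by gcongr)) (hw ω) <;> simp only [mem_Ioi] <;>
      positivity
  · filter_upwards [hZ.ae_mul_notMem hD.countable_not_continuousWithinAt hc₀.ne'] with ω hω
    have hz := hZ.pos ω
    have hcont : ContinuousWithinAt D (Ioi 0) (c₀ * Z ω) := by
      by_contra h
      exact hω ⟨mul_pos hc₀ hz, h⟩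
    refine continuousWithinAt_const.mul (ContinuousWithinAt.comp (f := fun c => c * Z ω) hcont
      (by fun_prop) fun c (hc : 0 < c) => mul_pos hc hz)

lemma tendsto_integral_mul_comp_atTop (hZ : IsStatePrice P Z) (hD : AntitoneOn D (Ioi 0))
    (hD0 : ∀ p, 0 < p → 0 ≤ D p) (hDL : Tendsto D atTop (𝓝 L)) (hw : ∀ ω, 0 ≤ w ω)
    (hint : ∀ c, 0 < c → Integrable (fun ω => w ω * D (c * Z ω)) P) :
    Tendsto (fun c => ∫ ω, w ω * D (c * Z ω) ∂P) atTop (𝓝 (∫ ω, w ω * L ∂P)) := by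
  refine tendsto_integral_filter_of_dominated_convergence (fun ω => w ω * D (1 * Z ω)) ?_ ?_
    (hint 1 one_pos) (Eventually.of_forall fun ω => ?_)
  · filter_upwards [eventually_gt_atTop 0] with c hc using (hint c hc).aestronglyMeasurable
  · filter_upwards [eventually_ge_atTop 1] with c hc
    refine Eventually.of_forall fun ω => ?_
    have hz := hZ.pos ω
    have hcz : 0 < c * Z ω := by positivity
    rw [Real.norm_of_nonneg (mul_nonneg (hw ω) (hD0 _ hcz))]
    exact mul_le_mul_of_nonneg_left (hD (by simpa using hz) hcz (by gcongr)) (hw ω)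
  · exact (hDL.comp (tendsto_id.atTop_mul_const (hZ.pos ω))).const_mul (w ω)

lemma tendsto_integral_mul (hZ : IsStatePrice P Z) {ι : Type*} {l : Filter ι}
    [l.IsCountablyGenerated] {Y : ι → Ω → ℝ} {Y₀ : Ω → ℝ} {R : ℝ}
    (hY : ∀ᶠ i in l, Measurable (Y i)) (hYR : ∀ᶠ i in l, ∀ ω, Y i ω ∈ Icc 0 R)
    (hlim : ∀ᵐ ω ∂P, Tendsto (fun i => Y i ω) l (𝓝 (Y₀ ω))) :
    Tendsto (fun i => ∫ ω, Z ω * Y i ω ∂P) l (𝓝 (∫ ω, Z ω * Y₀ ω ∂P)) := by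
  refine tendsto_integral_filter_of_dominated_convergence (fun ω => Z ω * R)
    (hY.mono fun i hi => (hZ.measurable.mul hi).aestronglyMeasurable) ?_
    (hZ.integrable.mul_const R) (hlim.mono fun ω hω => hω.const_mul (Z ω))
  filter_upwards [hYR] with i hi
  refine Eventually.of_forall fun ω => ?_
  rw [Real.norm_of_nonneg (mul_nonneg (hZ.pos ω).le (hi ω).1)]
  exact mul_le_mul_of_nonneg_left (hi ω).2 (hZ.pos ω).le

lemma integrable_rpow_mul_growthBound (hZ : IsStatePrice P Z) (ha : 0 ≤ a) (q : ℝ) :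
    Integrable (fun ω => Z ω ^ q * growthBound α (a / Z ω)) P := by
  set e := 1 / (1 - α) with he
  have h := ((hZ.integrable_rpow (q - 1)).const_mul a).add
    ((hZ.integrable_rpow (q - e)).const_mul (a ^ e))
  refine h.congr (Eventually.of_forall fun ω => ?_)
  have hz := hZ.pos ω
  simp only [Pi.add_apply]
  rw [growthBound, Real.div_rpow ha hz.le, Real.rpow_sub hz, Real.rpow_sub hz, Real.rpow_one, ← he]
  ring

lemma integrable_mul_growthBound (hZ : IsStatePrice P Z) (ha : 0 ≤ a) :
    Integrable (fun ω => Z ω * growthBound α (a / Z ω)) P := by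
  simpa using hZ.integrable_rpow_mul_growthBound ha 1

lemma integrable_growthBound (hZ : IsStatePrice P Z) (ha : 0 ≤ a) :
    Integrable (fun ω => growthBound α (a / Z ω)) P := by
  simpa using hZ.integrable_rpow_mul_growthBound ha 0

lemma exists_forall_le_of_integral_mul_comp_le [IsProbabilityMeasure P]
    (hZ : IsStatePrice P Z) (hD : AntitoneOn D (Ioi 0)) (hD0 : ∀ p, 0 < p → 0 ≤ D p)
    (hint : ∀ c, 0 < c → Integrable (fun ω => Z ω * D (c * Z ω)) P) {C : ℝ}
    (hC : ∀ c, 0 < c → ∫ ω, Z ω * D (c * Z ω) ∂P ≤ C) : ∃ R, ∀ p, 0 < p → D p ≤ R := by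
  set z := ∫ ω, Z ω ∂P
  set s := {ω | Z ω ≤ z}
  have hs : MeasurableSet s := hZ.measurable measurableSet_Iic
  have hPs : 0 < P s := measure_le_integral_pos hZ.integrable
  have hz : 0 < z := by
    obtain ⟨ω, hω⟩ := nonempty_of_measure_ne_zero hPs.ne'
    exact (hZ.pos ω).trans_le hω
  have hX : 0 < ∫ ω in s, Z ω ∂P := by
    rw [setIntegral_pos_iff_support_of_nonneg_ae (Eventually.of_forall fun ω => (hZ.pos ω).le)
      hZ.integrable.integrableOn, Function.support_eq_univ fun ω => (hZ.pos ω).ne', univ_inter]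
    exact hPs
  refine ⟨C / ∫ ω in s, Z ω ∂P, fun p hp => (le_div_iff₀ hX).2 ?_⟩
  have hc : 0 < p / z := div_pos hp hz
  calc D p * ∫ ω in s, Z ω ∂P = ∫ ω in s, Z ω * D p ∂P := by rw [integral_mul_const, mul_comm]
    _ ≤ ∫ ω in s, Z ω * D (p / z * Z ω) ∂P := by
        refine setIntegral_mono_on (hZ.integrable.mul_const _).integrableOn
          (hint _ hc).integrableOn hs fun ω (hω : Z ω ≤ z) => ?_
        have hprice : p / z * Z ω ≤ p := by
          calc p / z * Z ω ≤ p / z * z := by gcongr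
            _ = p := div_mul_cancel₀ p hz.ne'
        exact mul_le_mul_of_nonneg_left (hD (mul_pos hc (hZ.pos ω)) hp hprice) (hZ.pos ω).le
    _ ≤ ∫ ω, Z ω * D (p / z * Z ω) ∂P := setIntegral_le_integral (hint _ hc) <|
        Eventually.of_forall fun ω =>
          mul_nonneg (hZ.pos ω).le (hD0 _ (mul_pos hc (hZ.pos ω)))
    _ ≤ C := hC _ hc

end IsStatePrice

lemma integrable_rpow_of_integrable [IsFiniteMeasure P] {Y : Ω → ℝ} (hα : α ∈ Icc (0 : ℝ) 1)
    (hY : Integrable Y P) (h0 : ∀ ω, 0 ≤ Y ω) : Integrable (fun ω => Y ω ^ α) P := by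
  refine Integrable.mono' ((integrable_const (1 : ℝ)).add hY)
    (hY.aemeasurable.pow_const α).aestronglyMeasurable (Eventually.of_forall fun ω => ?_)
  rw [Real.norm_of_nonneg (Real.rpow_nonneg (h0 ω) α), Pi.add_apply]
  exact rpow_le_one_add hα (h0 ω)

lemma tendsto_integral_rpow [IsFiniteMeasure P] {ι : Type*} {l : Filter ι}
    [l.IsCountablyGenerated] {Y : ι → Ω → ℝ} {X Y₀ : Ω → ℝ} (hα : α ∈ Icc (0 : ℝ) 1)
    (hX : Integrable X P) (hY : ∀ᶠ i in l, Measurable (Y i))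
    (hYX : ∀ᶠ i in l, ∀ ω, Y i ω ∈ Icc 0 (X ω))
    (hlim : ∀ᵐ ω ∂P, Tendsto (fun i => Y i ω) l (𝓝 (Y₀ ω))) :
    Tendsto (fun i => ∫ ω, Y i ω ^ α ∂P) l (𝓝 (∫ ω, Y₀ ω ^ α ∂P)) := by
  refine tendsto_integral_filter_of_dominated_convergence (fun ω => 1 + X ω)
    (hY.mono fun i hi => (hi.pow_const α).aestronglyMeasurable) ?_
    ((integrable_const _).add hX) (hlim.mono fun ω hω => hω.rpow_const (Or.inr hα.1))
  filter_upwards [hYX] with i hi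
  refine Eventually.of_forall fun ω => ?_
  rw [Real.norm_of_nonneg (Real.rpow_nonneg (hi ω).1 α)]
  linarith [rpow_le_one_add hα (hi ω).1, (hi ω).2]

end StatePrice

namespace Model

variable (M : Model)

section Utility

variable {y : ℝ}

lemma U_of_nonneg {x : ℝ} (hx : 0 ≤ x) : M.U x = x ^ M.α := if_pos hx

lemma U_of_nonpos {x : ℝ} (hx : x ≤ 0) : M.U x = -M.k * (-x) ^ M.α := by
  rcases hx.eq_or_lt with rfl | hx
  · simp [U, Real.zero_rpow M.α_pos.ne']
  · rw [U, if_neg (not_le.2 hx), abs_of_neg hx]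

lemma continuous_U : Continuous M.U := by
  have hα := M.α_pos.le
  refine Continuous.if_le (continuous_id.rpow_const fun _ => Or.inr hα)
    (continuous_const.mul (continuous_abs.rpow_const fun _ => Or.inr hα))
    continuous_const continuous_id ?_
  rintro _ rfl
  simp [Real.zero_rpow M.α_pos.ne']

lemma U_sub_le_rpow (hy : 0 ≤ y) : M.U (y - M.γ) ≤ y ^ M.α := by
  have hγ := M.γ_pos
  rcases le_total 0 (y - M.γ) with h | h
  · rw [M.U_of_nonneg h]
    exact Real.rpow_le_rpow h (by linarith) M.α_pos.le
  · rw [M.U_of_nonpos h]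
    have hloss := mul_nonneg M.k_nonneg (Real.rpow_nonneg (neg_nonneg.2 h) M.α)
    linarith [Real.rpow_nonneg hy M.α]

lemma le_U_sub (hy : 0 ≤ y) : -(M.k * M.γ ^ M.α) ≤ M.U (y - M.γ) := by
  have hγ := M.γ_pos
  rcases le_total 0 (y - M.γ) with h | h
  · rw [M.U_of_nonneg h]
    linarith [mul_nonneg M.k_nonneg (Real.rpow_nonneg hγ.le M.α), Real.rpow_nonneg h M.α]
  · rw [M.U_of_nonpos h, neg_mul, neg_le_neg_iff]
    exact mul_le_mul_of_nonneg_left (Real.rpow_le_rpow (by linarith) (by linarith) M.α_pos.le)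
      M.k_nonneg

lemma continuous_F : Continuous fun q : ℝ × ℝ => M.F q.1 q.2 :=
  (M.continuous_U.comp (continuous_fst.sub continuous_const)).add
    (continuous_snd.mul (continuous_fst.rpow_const fun _ => Or.inr M.α_pos.le))

lemma continuous_F_left (θ : ℝ) : Continuous (M.F · θ) :=
  M.continuous_F.comp (.prodMk_left θ)

lemma F_zero_left (θ : ℝ) : M.F 0 θ = -(M.k * M.γ ^ M.α) := by
  rw [F, zero_sub, M.U_of_nonpos (by linarith [M.γ_pos]), neg_neg, Real.zero_rpow M.α_pos.ne',
    mul_zero, add_zero, neg_mul]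

lemma F_zero_right (y : ℝ) : M.F y 0 = M.U (y - M.γ) := by rw [F, zero_mul, add_zero]

lemma F_le (hy : 0 ≤ y) (θ : ℝ) : M.F y θ ≤ (1 + θ) * y ^ M.α := by
  have := M.U_sub_le_rpow hy
  rw [F]
  linarith

lemma F_add (y θ η : ℝ) : M.F y (θ + η) = M.F y θ + η * y ^ M.α := by
  rw [F, F]
  ring

lemma F_eq_add_sub (y θ θ' : ℝ) : M.F y θ' = M.F y θ + (θ' - θ) * y ^ M.α := by
  rw [← F_add, add_sub_cancel]

lemma F_neg_one_neg (hk : 0 < M.k) (hy : 0 ≤ y) : M.F y (-1) < 0 := by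
  have hγ := M.γ_pos
  have hα := M.α_pos
  rw [F]
  rcases lt_or_ge y M.γ with h | h
  · rw [M.U_of_nonpos (by linarith)]
    have hloss : 0 < M.k * (-(y - M.γ)) ^ M.α :=
      mul_pos hk (Real.rpow_pos_of_pos (by linarith) _)
    linarith [Real.rpow_nonneg hy M.α]
  · rw [M.U_of_nonneg (by linarith)]
    linarith [Real.rpow_lt_rpow (by linarith : 0 ≤ y - M.γ) (by linarith : y - M.γ < y) hα]

lemma le_F_of_lt (hy : M.γ < y) (θ : ℝ) :
    (1 + θ) * y ^ M.α - M.γ * (y - M.γ) ^ (M.α - 1) ≤ M.F y θ := by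
  have hx : 0 < y - M.γ := sub_pos.2 hy
  have hγ := M.γ_pos
  have hbase : 1 ≤ 1 + M.γ / (y - M.γ) := le_add_of_nonneg_right (by positivity)
  have hsplit : y ^ M.α ≤ (y - M.γ) ^ M.α + M.γ * (y - M.γ) ^ (M.α - 1) :=
    calc y ^ M.α = (y - M.γ) ^ M.α * (1 + M.γ / (y - M.γ)) ^ M.α := by
          rw [← Real.mul_rpow hx.le (by linarith)]
          congr 1
          field_simp
          ring
      _ ≤ (y - M.γ) ^ M.α * (1 + M.γ / (y - M.γ)) := by
          gcongr
          exact Real.rpow_le_self_of_one_le hbase M.α_lt_one.le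
      _ = _ := by
          rw [Real.rpow_sub_one hx.ne']
          ring
  rw [F, M.U_of_nonneg hx.le]
  linarith

lemma tendsto_mul_rpow_sub_atTop :
    Tendsto (fun y => M.γ * (y - M.γ) ^ (M.α - 1)) atTop (𝓝 0) := by
  have h := (tendsto_rpow_neg_atTop (sub_pos.2 M.α_lt_one)).comp
    (tendsto_atTop_add_const_right atTop (-M.γ) tendsto_id)
  simpa [Function.comp_def, sub_eq_add_neg] using h.const_mul M.γ

end Utility

section MarketDemand

variable {p θ T y : ℝ}

/-- The scale of the growth bound on the demand for `F(·; θ)`, valid for all `θ ≤ T`. -/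
noncomputable def demandScale (T : ℝ) : ℝ := 2 * (1 + T + M.k * M.γ ^ M.α)

lemma demandScale_nonneg (hT : 0 ≤ T) : 0 ≤ M.demandScale T := by
  have := mul_nonneg M.k_nonneg (Real.rpow_nonneg M.γ_pos.le M.α)
  rw [demandScale]
  positivity

lemma le_growthBound_of_F_zero_le (hp : 0 < p) (hθ : θ ≤ T) (hT : 0 ≤ T) (hy : 0 ≤ y)
    (h : M.F 0 θ - p * 0 ≤ M.F y θ - p * y) : y ≤ growthBound M.α (M.demandScale T / p) := by
  have hkγ := mul_nonneg M.k_nonneg (Real.rpow_nonneg M.γ_pos.le M.α)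
  have hyα := Real.rpow_nonneg hy M.α
  refine le_growthBound ⟨M.α_pos, M.α_lt_one⟩ (by positivity) hp hy ?_
  rw [F_zero_left] at h
  nlinarith [M.F_le hy θ]

lemma le_growthBound_of_mem_demandSet (hp : 0 < p) (hθ : θ ≤ T) (hT : 0 ≤ T)
    (hy : y ∈ demandSet (Ici 0) (M.F · θ) p) : y ≤ growthBound M.α (M.demandScale T / p) :=
  M.le_growthBound_of_F_zero_le hp hθ hT hy.1 (hy.2 0 self_mem_Ici)

lemma demand_F_mem (hp : 0 < p) (θ : ℝ) :
    demand (Ici 0) (M.F · θ) p ∈ demandSet (Ici 0) (M.F · θ) p :=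
  demand_mem_demandSet isClosed_Ici subset_rfl (M.continuous_F_left θ) <|
    demandSet_nonempty_of_forall_le isClosed_Ici subset_rfl (M.continuous_F_left θ) self_mem_Ici
      fun _ hy h => M.le_growthBound_of_F_zero_le hp (le_abs_self θ) (abs_nonneg θ) hy h

lemma antitoneOn_demand_F (θ : ℝ) : AntitoneOn (demand (Ici 0) (M.F · θ)) (Ioi 0) :=
  antitoneOn_demand fun _ hp => M.demand_F_mem hp θ

lemma lt_neg_one_of_mem_demandSet_zero (hθ : -1 < θ ∨ 0 < M.k)
    (hy : y ∈ demandSet (Ici 0) (M.F · θ) 0) : θ < -1 := by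
  have hbound : ∀ᶠ x in atTop, (1 + θ) * x ^ M.α - M.γ * (x - M.γ) ^ (M.α - 1) ≤ M.F y θ := by
    filter_upwards [eventually_gt_atTop M.γ] with x hx
    have hmax := hy.2 x (M.γ_pos.trans hx).le
    linarith [M.le_F_of_lt hx θ]
  by_contra! hge
  rcases hge.eq_or_lt with rfl | hlt
  · have hlim := M.tendsto_mul_rpow_sub_atTop.const_sub 0
    have h0 : (0 : ℝ) - 0 ≤ M.F y (-1) := le_of_tendsto hlim (by simpa using hbound)
    linarith [M.F_neg_one_neg (hθ.resolve_left (lt_irrefl _)) hy.1]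
  · have hlim : Tendsto (fun x => (1 + θ) * x ^ M.α - M.γ * (x - M.γ) ^ (M.α - 1)) atTop atTop :=
      ((tendsto_rpow_atTop M.α_pos).const_mul_atTop (by linarith)).atTop_add
        M.tendsto_mul_rpow_sub_atTop.neg
    obtain ⟨x, hle, hgt⟩ := (hbound.and (hlim.eventually_gt_atTop (M.F y θ))).exists
    exact hle.not_gt hgt

/-- The common bound of the quantities demanded at all prices `p ≥ 0` when `θ ≤ T < -1`. -/
noncomputable def satiationBound (T : ℝ) : ℝ := (M.k * M.γ ^ M.α / (-1 - T)) ^ (1 / M.α)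

lemma le_satiationBound_of_F_zero_le (hp : 0 ≤ p) (hθ : θ ≤ T) (hT : T < -1) (hy : 0 ≤ y)
    (h : M.F 0 θ - p * 0 ≤ M.F y θ - p * y) : y ≤ M.satiationBound T := by
  have hα := M.α_pos
  have hyα := Real.rpow_nonneg hy M.α
  rw [F_zero_left] at h
  have hle : y ^ M.α ≤ M.k * M.γ ^ M.α / (-1 - T) := by
    rw [le_div_iff₀ (by linarith)]
    nlinarith [M.F_le hy θ, mul_nonneg hp hy]
  calc y = (y ^ M.α) ^ (1 / M.α) := by
        rw [← Real.rpow_mul hy, mul_one_div_cancel hα.ne', Real.rpow_one]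
    _ ≤ M.satiationBound T := Real.rpow_le_rpow hyα hle (by positivity)

lemma le_satiationBound_of_mem_demandSet (hp : 0 ≤ p) (hθ : θ ≤ T) (hT : T < -1)
    (hy : y ∈ demandSet (Ici 0) (M.F · θ) p) : y ≤ M.satiationBound T :=
  M.le_satiationBound_of_F_zero_le hp hθ hT hy.1 (hy.2 0 self_mem_Ici)

end MarketDemand

section Satiation

variable {p θ θ' x y z : ℝ}

/-- The satiation points of `F(·; θ)`: its maximizers on `[0, ∞)`, that is, the quantities demanded
of a free good. -/
def satiationSet (θ : ℝ) : Set ℝ := demandSet (Ici 0) (M.F · θ) 0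

/-- The demand of an agent with utility `y ^ α` who consumes satiation points of `F(·; θ)` only; it
is the limit of the demand for `F(·; θ')` at the price `(θ' - θ) x` as `θ'` decreases to `θ`. -/
noncomputable def satiatedDemand (θ x : ℝ) : ℝ := demand (M.satiationSet θ) (· ^ M.α) x

lemma isClosed_satiationSet (θ : ℝ) : IsClosed (M.satiationSet θ) :=
  isClosed_demandSet isClosed_Ici (M.continuous_F_left θ)

lemma satiationSet_subset_Icc (hθ : θ < -1) :
    M.satiationSet θ ⊆ Icc 0 (M.satiationBound θ) := fun _ hy =>
  ⟨hy.1, M.le_satiationBound_of_mem_demandSet le_rfl le_rfl hθ hy⟩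

lemma satiationSet_nonempty (hθ : θ < -1) : (M.satiationSet θ).Nonempty :=
  demandSet_nonempty_of_forall_le isClosed_Ici subset_rfl (M.continuous_F_left θ) self_mem_Ici
    fun _ hy h => M.le_satiationBound_of_F_zero_le le_rfl le_rfl hθ hy h

lemma isCompact_satiationSet (hθ : θ < -1) : IsCompact (M.satiationSet θ) :=
  isCompact_Icc.of_isClosed_subset (M.isClosed_satiationSet θ) (M.satiationSet_subset_Icc hθ)

lemma continuous_rpow_α : Continuous (· ^ M.α : ℝ → ℝ) :=
  continuous_id.rpow_const fun _ => Or.inr M.α_pos.le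

lemma satiatedDemand_mem (hθ : θ < -1) (x : ℝ) :
    M.satiatedDemand θ x ∈ demandSet (M.satiationSet θ) (· ^ M.α) x := by
  have hS0 : M.satiationSet θ ⊆ Ici 0 := fun _ hy => hy.1
  obtain ⟨y₀, hy₀⟩ := M.satiationSet_nonempty hθ
  exact demand_mem_demandSet (M.isClosed_satiationSet θ) hS0 M.continuous_rpow_α <|
    demandSet_nonempty_of_forall_le (M.isClosed_satiationSet θ) hS0 M.continuous_rpow_α hy₀
      fun y hy _ => (M.satiationSet_subset_Icc hθ hy).2

lemma satiatedDemand_mem_Icc (hθ : θ < -1) (x : ℝ) :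
    M.satiatedDemand θ x ∈ Icc 0 (M.satiationBound θ) :=
  M.satiationSet_subset_Icc hθ (M.satiatedDemand_mem hθ x).1

lemma antitoneOn_satiatedDemand (hθ : θ < -1) : AntitoneOn (M.satiatedDemand θ) (Ioi 0) :=
  antitoneOn_demand fun x _ => M.satiatedDemand_mem hθ x

lemma tendsto_satiatedDemand_atTop (hθ : θ < -1) (hy : IsLeast (M.satiationSet θ) y) :
    Tendsto (M.satiatedDemand θ) atTop (𝓝 y) :=
  tendsto_demand_atTop (M.isClosed_satiationSet θ) (M.satiationSet_subset_Icc hθ)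
    M.continuous_rpow_α hy

lemma tendsto_satiatedDemand_zero (hθ : θ < -1) (hy : IsGreatest (M.satiationSet θ) y) :
    Tendsto (M.satiatedDemand θ) (𝓝[>] 0) (𝓝 y) := by
  refine tendsto_of_mem_demandSet_of_subset_singleton (G := fun z _ => z ^ M.α) (θ := fun _ => 0)
    (M.isClosed_satiationSet θ) (M.continuous_rpow_α.comp continuous_fst)
    (tendsto_id.mono_left nhdsWithin_le_nhds) tendsto_const_nhds
    (Eventually.of_forall (M.satiatedDemand_mem_Icc hθ))
    (Eventually.of_forall (M.satiatedDemand_mem hθ)) fun z hz => ?_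
  have hle := hz.2 y hy.1
  simp only [zero_mul, sub_zero] at hle
  exact le_antisymm (hy.2 hz.1) ((Real.rpow_le_rpow_iff hy.1.1 hz.1.1 M.α_pos).1 hle)

lemma rpow_sub_le_of_mem_demandSet (hθ : θ < θ') (hz : z ∈ M.satiationSet θ)
    (hy : y ∈ demandSet (Ici 0) (M.F · θ') ((θ' - θ) * x)) :
    z ^ M.α - x * z ≤ y ^ M.α - x * y := by
  have hmax := hz.2 y hy.1
  have hmax' := hy.2 z hz.1
  simp only [M.F_eq_add_sub _ θ θ'] at hmax hmax'
  refine le_of_mul_le_mul_left ?_ (sub_pos.2 hθ)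
  linarith

lemma tendsto_demand_satiatedDemand (hθ : θ < -1) (hx : 0 < x)
    (huniq : demandSet (M.satiationSet θ) (· ^ M.α) x ⊆ {M.satiatedDemand θ x}) :
    Tendsto (fun θ' => demand (Ici 0) (M.F · θ') ((θ' - θ) * x)) (𝓝[>] θ)
      (𝓝 (M.satiatedDemand θ x)) := by
  have hT : (θ - 1) / 2 < -1 := by linarith
  have hnear : ∀ᶠ θ' in 𝓝[>] θ, θ < θ' ∧ θ' ≤ (θ - 1) / 2 :=
    (Ioc_mem_nhdsGT (by linarith : θ < (θ - 1) / 2))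
  have hmem : ∀ᶠ θ' in 𝓝[>] θ, demand (Ici 0) (M.F · θ') ((θ' - θ) * x) ∈
      demandSet (Ici 0) (M.F · θ') ((θ' - θ) * x) :=
    hnear.mono fun θ' h => M.demand_F_mem (mul_pos (sub_pos.2 h.1) hx) θ'
  refine tendsto_of_forall_ultrafilter (a := 0) (b := M.satiationBound ((θ - 1) / 2)) ?_ ?_
  · filter_upwards [hnear, hmem] with θ' h hy
    exact ⟨hy.1, M.le_satiationBound_of_mem_demandSet
      (mul_nonneg (sub_pos.2 h.1).le hx.le) h.2 hT hy⟩
  · intro u z hu hz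
    have hprice : Tendsto (fun θ' => (θ' - θ) * x) u (𝓝 0) :=
      (Continuous.tendsto' (by fun_prop) θ 0 (by simp)).mono_left (hu.trans nhdsWithin_le_nhds)
    have hzS : z ∈ M.satiationSet θ := mem_demandSet_of_tendsto isClosed_Ici M.continuous_F hprice
      (tendsto_id.mono_left (hu.trans nhdsWithin_le_nhds)) hz (hmem.filter_mono hu)
    refine huniq ⟨hzS, fun z' hz' => ?_⟩
    refine _root_.ge_of_tendsto ((hz.rpow_const (Or.inr M.α_pos.le)).sub (hz.const_mul x)) ?_
    filter_upwards [(hnear.and hmem).filter_mono hu] with θ' h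
    exact M.rpow_sub_le_of_mem_demandSet h.1.1 hz' h.2

lemma le_of_mem_demandSet_F (hθ : θ < θ') (hy : y ∈ demandSet (Ici 0) (M.F · θ) p)
    (hz : z ∈ demandSet (Ici 0) (M.F · θ') p) : y ≤ z := by
  have hmax := hy.2 z hz.1
  have hmax' := hz.2 y hy.1
  simp only [M.F_eq_add_sub _ θ θ'] at hmax hmax'
  refine (Real.rpow_le_rpow_iff hy.1 hz.1 M.α_pos).1 (le_of_mul_le_mul_left ?_ (sub_pos.2 hθ))
  linarith

lemma demand_zero_mem_satiationSet (hθ : θ < -1) :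
    demand (Ici 0) (M.F · θ) 0 ∈ M.satiationSet θ :=
  demand_mem_demandSet isClosed_Ici subset_rfl (M.continuous_F_left θ) (M.satiationSet_nonempty hθ)

lemma tendsto_demand_zero (hθ : θ < -1) :
    Tendsto (fun θ' => demand (Ici 0) (M.F · θ') 0) (𝓝[<] θ)
      (𝓝 (demand (Ici 0) (M.F · θ) 0)) := by
  have hlt : ∀ᶠ θ' in 𝓝[<] θ, θ' < θ := self_mem_nhdsWithin
  have hle : ∀ᶠ θ' in 𝓝[<] θ, demand (Ici 0) (M.F · θ') 0 ≤ demand (Ici 0) (M.F · θ) 0 :=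
    hlt.mono fun θ' h => M.le_of_mem_demandSet_F h (M.demand_zero_mem_satiationSet (h.trans hθ))
      (M.demand_zero_mem_satiationSet hθ)
  have hmem : ∀ᶠ θ' in 𝓝[<] θ, demand (Ici 0) (M.F · θ') 0 ∈ demandSet (Ici 0) (M.F · θ') 0 :=
    hlt.mono fun θ' h => M.demand_zero_mem_satiationSet (h.trans hθ)
  refine tendsto_of_forall_ultrafilter ((hmem.and hle).mono fun θ' h => ⟨h.1.1, h.2⟩) ?_
  intro u z hu hz
  have hzS : z ∈ M.satiationSet θ := mem_demandSet_of_tendsto isClosed_Ici M.continuous_F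
    tendsto_const_nhds (tendsto_id.mono_left (hu.trans nhdsWithin_le_nhds)) hz (hmem.filter_mono hu)
  exact le_antisymm (_root_.le_of_tendsto hz (hle.filter_mono hu)) (demand_le subset_rfl hzS)

end Satiation

end Model

section PricingKernel

variable {Ω : Type*} [MeasurableSpace Ω] {P : Measure Ω} {B : ℝ≥0 → Ω → ℝ} {M : Model} {t : ℝ≥0}

lemma measurable_of_isBrownianReal [P.IsComplete] (hB : IsBrownianReal B P) (t : ℝ≥0) :
    Measurable (B t) :=
  (hB.toIsPreBrownianReal.aemeasurable t).nullMeasurable.measurable_of_complete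

lemma augmentedSigma_le [P.IsComplete] (hB : IsBrownianReal B P) (t : ℝ≥0) :
    augmentedSigma P B t ≤ ‹MeasurableSpace Ω› := by
  have hle : (⨆ s : Iic t, MeasurableSpace.comap (fun ω => B s ω - B 0 ω) inferInstance) ≤
      ‹MeasurableSpace Ω› := iSup_le fun s =>
    ((measurable_of_isBrownianReal hB s).sub (measurable_of_isBrownianReal hB 0)).comap_le
  rintro s ⟨u, hu, hsu⟩
  exact ((hle u hu).nullMeasurableSet.congr hsu.symm).measurable_of_complete

lemma measurable_augmentedSigma_eval (hB : IsBrownianReal B P) (t : ℝ≥0) :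
    Measurable[augmentedSigma P B t] (B t) := by
  have hinc : Measurable[⨆ s : Iic t,
      MeasurableSpace.comap (fun ω => B s ω - B 0 ω) inferInstance] (fun ω => B t ω - B 0 ω) :=
    measurable_iff_comap_le.2 (le_iSup (fun s : Iic t =>
      MeasurableSpace.comap (fun ω => B s ω - B 0 ω) inferInstance) ⟨t, self_mem_Iic⟩)
  refine EventuallyMeasurable.congr (l := ae P) hinc.eventuallyMeasurable ?_
  filter_upwards [hB.toIsPreBrownianReal.eval_zero_ae_eq_zero] with ω hω
  rw [hω, sub_zero]

lemma measurable_augmentedSigma_pricingKernel (hB : IsBrownianReal B P) (t : ℝ≥0) :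
    Measurable[augmentedSigma P B t] (pricingKernel M B t) :=
  have hexp : Measurable fun x : ℝ =>
    Real.exp (-M.sharpe * x - (M.r + M.sharpe ^ 2 / 2) * (t : ℝ)) := by fun_prop
  hexp.comp (measurable_augmentedSigma_eval hB t)

omit [MeasurableSpace Ω] in
lemma pricingKernel_pos (ω : Ω) : 0 < pricingKernel M B t ω := Real.exp_pos _

omit [MeasurableSpace Ω] in
lemma pricingKernel_rpow (q : ℝ) (ω : Ω) :
    pricingKernel M B t ω ^ q = Real.exp (-(q * M.sharpe) * B t ω) *
      Real.exp (-(q * (M.r + M.sharpe ^ 2 / 2) * t)) := by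
  rw [pricingKernel, ← Real.exp_mul, ← Real.exp_add]
  ring_nf

lemma integrable_pricingKernel_rpow (hB : IsBrownianReal B P) (q : ℝ) :
    Integrable (fun ω => pricingKernel M B t ω ^ q) P := by
  have hlaw := hB.toIsPreBrownianReal.hasLaw_eval t
  have hexp : Integrable (fun x => Real.exp (-(q * M.sharpe) * x)) (P.map (B t)) := by
    rw [hlaw.map_eq]
    exact integrable_exp_mul_gaussianReal _
  simp_rw [pricingKernel_rpow]
  exact (hexp.comp_aemeasurable hlaw.aemeasurable).mul_const _

lemma integral_pricingKernel_rpow (hB : IsBrownianReal B P) (t : ℝ≥0) :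
    ∫ ω, pricingKernel M B t ω ^ (-(M.α / (1 - M.α))) ∂P = Real.exp (M.h * t / (1 - M.α)) := by
  have hmgf := mgf_gaussianReal (hB.toIsPreBrownianReal.hasLaw_eval t).map_eq
    (-(-(M.α / (1 - M.α)) * M.sharpe))
  have hα1 : 1 - M.α ≠ 0 := (sub_pos.2 M.α_lt_one).ne'
  rw [mgf] at hmgf
  simp_rw [pricingKernel_rpow]
  rw [integral_mul_const, hmgf, ← Real.exp_add, Model.h]
  congr 1
  field_simp
  ring

lemma ae_pricingKernel_ne (hB : IsBrownianReal B P) (ht : t ≠ 0) (z : ℝ) :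
    ∀ᵐ ω ∂P, pricingKernel M B t ω ≠ z := by
  have hlaw := hB.toIsPreBrownianReal.hasLaw_eval t
  have := nullSingletonClass_gaussianReal (μ := 0) ht
  set f : ℝ → ℝ := fun x => Real.exp (-M.sharpe * x - (M.r + M.sharpe ^ 2 / 2) * t)
  have hf : Function.Injective f := fun x y hxy => by
    have hexp := Real.exp_injective hxy
    exact mul_left_cancel₀ M.sharpe_ne_zero (by simp only [Model.sharpe] at hexp; linarith)
  have hnull : ∀ᵐ x ∂(P.map (B t)), x ∉ f ⁻¹' {z} := by
    rw [hlaw.map_eq]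
    exact measure_eq_zero_iff_ae_notMem.1
      (((countable_singleton z).preimage_of_injOn hf.injOn).measure_zero _)
  exact ae_of_ae_map hlaw.aemeasurable hnull

lemma isStatePrice_pricingKernel [P.IsComplete] (hB : IsBrownianReal B P) (ht : t ≠ 0) :
    IsStatePrice P (pricingKernel M B t) where
  measurable := (measurable_augmentedSigma_pricingKernel hB t).mono (augmentedSigma_le hB t) le_rfl
  pos := pricingKernel_pos
  integrable_rpow := integrable_pricingKernel_rpow hB
  ae_ne := ae_pricingKernel_ne hB ht

end PricingKernel

/-- The pricing kernel `Z_τ` of one evaluation period. -/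
noncomputable abbrev periodKernel {Ω : Type*} (M : Model) (B : ℝ≥0 → Ω → ℝ) : Ω → ℝ :=
  pricingKernel M B M.τ.toNNReal

/-- The upper bound `e^{h τ}` of the power moments `E[Y ^ α]` of the attainable returns. -/
noncomputable def Model.maxMoment (M : Model) : ℝ≥0 := ⟨Real.exp (M.h * M.τ), (Real.exp_pos _).le⟩

section Returns

lemma lintegral_rpow_le_of_pos {Ω : Type*} [MeasurableSpace Ω] {P : Measure Ω} {Z Y : Ω → ℝ}
    {α : ℝ} (hα : α ∈ Ioo (0 : ℝ) 1) (hZ : Measurable Z) (hZ0 : ∀ ω, 0 < Z ω) (hY : Measurable Y)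
    (hY0 : ∀ᵐ ω ∂P, 0 ≤ Y ω) :
    ∫⁻ ω, ENNReal.ofReal (Y ω ^ α) ∂P ≤ (∫⁻ ω, ENNReal.ofReal (Z ω * Y ω) ∂P) ^ α *
      (∫⁻ ω, ENNReal.ofReal (Z ω ^ (-(α / (1 - α)))) ∂P) ^ (1 - α) := by
  have hα1 : 0 < 1 - α := sub_pos.2 hα.2
  refine le_of_eq_of_le (lintegral_congr_ae ?_) <| ENNReal.lintegral_mul_norm_pow_le
    (hZ.mul hY).ennreal_ofReal.aemeasurable (hZ.pow_const _).ennreal_ofReal.aemeasurable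
    hα.1.le hα1.le (by ring)
  filter_upwards [hY0] with ω hω
  have hz := hZ0 ω
  rw [Pi.mul_apply, ENNReal.ofReal_rpow_of_nonneg (mul_nonneg hz.le hω) hα.1.le,
    ENNReal.ofReal_rpow_of_nonneg (Real.rpow_nonneg hz.le _) hα1.le,
    ← ENNReal.ofReal_mul (Real.rpow_nonneg (mul_nonneg hz.le hω) _),
    Real.mul_rpow hz.le hω, ← Real.rpow_mul hz.le, neg_mul, div_mul_cancel₀ _ hα1.ne',
    mul_right_comm, ← Real.rpow_add hz, add_neg_cancel, Real.rpow_zero, one_mul]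

variable {Ω : Type*} [MeasurableSpace Ω] {P : Measure Ω} {B : ℝ≥0 → Ω → ℝ} {M : Model} {Y : Ω → ℝ}

lemma mem_returns_of_integral_le (hm : Measurable[augmentedSigma P B M.τ.toNNReal] Y)
    (h0 : ∀ ω, 0 ≤ Y ω) (hint : Integrable (fun ω => periodKernel M B ω * Y ω) P)
    (hle : ∫ ω, periodKernel M B ω * Y ω ∂P ≤ 1) : Y ∈ returns M P B := by
  refine ⟨hm, Eventually.of_forall h0, ?_⟩
  rw [← ofReal_integral_eq_lintegral_ofReal hint
    (Eventually.of_forall fun ω => mul_nonneg (pricingKernel_pos ω).le (h0 ω))]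
  exact ENNReal.ofReal_le_one.2 hle

lemma zero_mem_returns : (fun _ => 0) ∈ returns M P B :=
  ⟨measurable_const, by simp, by simp⟩

lemma integral_rpow_nonneg (hY : Y ∈ returns M P B) : 0 ≤ ∫ ω, Y ω ^ M.α ∂P :=
  integral_nonneg_of_ae (hY.2.1.mono fun _ hω => Real.rpow_nonneg hω _)

lemma ae_periodKernel_mul_nonneg (hY : Y ∈ returns M P B) :
    ∀ᵐ ω ∂P, 0 ≤ periodKernel M B ω * Y ω :=
  hY.2.1.mono fun ω hω => mul_nonneg (pricingKernel_pos ω).le hω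

lemma AMy_eq : AMy M P B = M.disc * Phi M P B 0 := by
  have hobj : objective M P 0 = fun Y : Ω → ℝ => ∫ ω, M.U (Y ω - M.γ) ∂P :=
    funext fun Y => by simp only [objective, Model.F_zero_right]
  rw [AMy, Phi, hobj]

lemma Phi_le {θ C : ℝ} (h : ∀ Y ∈ returns M P B, objective M P θ Y ≤ C) : Phi M P B θ ≤ C :=
  csSup_le (Nonempty.image _ ⟨_, zero_mem_returns⟩) (forall_mem_image.2 h)

variable [P.IsComplete]

lemma isStatePrice_periodKernel (hB : IsBrownianReal B P) : IsStatePrice P (periodKernel M B) :=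
  isStatePrice_pricingKernel hB (by simpa using M.τ_pos)

lemma measurable_of_mem_returns (hB : IsBrownianReal B P) (hY : Y ∈ returns M P B) :
    Measurable Y := hY.1.mono (augmentedSigma_le hB _) le_rfl

lemma integrable_mul_of_mem_returns (hB : IsBrownianReal B P) (hY : Y ∈ returns M P B) :
    Integrable (fun ω => periodKernel M B ω * Y ω) P :=
  (lintegral_ofReal_ne_top_iff_integrable ((isStatePrice_periodKernel hB).measurable.mul
    (measurable_of_mem_returns hB hY)).aestronglyMeasurable (ae_periodKernel_mul_nonneg hY)).1
    (hY.2.2.trans_lt ENNReal.one_lt_top).ne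

lemma integral_mul_le_of_mem_returns (hB : IsBrownianReal B P) (hY : Y ∈ returns M P B) :
    ∫ ω, periodKernel M B ω * Y ω ∂P ≤ 1 := by
  rw [← ENNReal.ofReal_le_one, ofReal_integral_eq_lintegral_ofReal
    (integrable_mul_of_mem_returns hB hY) (ae_periodKernel_mul_nonneg hY)]
  exact hY.2.2

lemma lintegral_rpow_le_maxMoment (hB : IsBrownianReal B P) (hY : Y ∈ returns M P B) :
    ∫⁻ ω, ENNReal.ofReal (Y ω ^ M.α) ∂P ≤ M.maxMoment := by
  have hα1 : 0 < 1 - M.α := sub_pos.2 M.α_lt_one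
  have hZ := isStatePrice_periodKernel (M := M) hB
  have hdual : (∫⁻ ω, ENNReal.ofReal (periodKernel M B ω ^ (-(M.α / (1 - M.α)))) ∂P) ^ (1 - M.α) =
      M.maxMoment := by
    rw [← ofReal_integral_eq_lintegral_ofReal (hZ.integrable_rpow _)
      (Eventually.of_forall fun ω => Real.rpow_nonneg (hZ.pos ω).le _),
      integral_pricingKernel_rpow hB, ENNReal.ofReal_rpow_of_nonneg (Real.exp_pos _).le hα1.le,
      ← Real.exp_mul, div_mul_cancel₀ _ hα1.ne', Real.coe_toNNReal _ M.τ_pos.le]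
    exact ENNReal.ofReal_eq_coe_nnreal _
  calc ∫⁻ ω, ENNReal.ofReal (Y ω ^ M.α) ∂P
      ≤ (∫⁻ ω, ENNReal.ofReal (periodKernel M B ω * Y ω) ∂P) ^ M.α * M.maxMoment := by
        rw [← hdual]
        exact lintegral_rpow_le_of_pos ⟨M.α_pos, M.α_lt_one⟩ hZ.measurable hZ.pos
          (measurable_of_mem_returns hB hY) hY.2.1
    _ ≤ 1 ^ M.α * M.maxMoment := by
        gcongr
        · exact M.α_pos.le
        · exact hY.2.2
    _ = M.maxMoment := by rw [ENNReal.one_rpow, one_mul]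

lemma integrable_rpow_of_mem_returns (hB : IsBrownianReal B P) (hY : Y ∈ returns M P B) :
    Integrable (fun ω => Y ω ^ M.α) P :=
  (lintegral_ofReal_ne_top_iff_integrable
    ((measurable_of_mem_returns hB hY).pow_const _).aestronglyMeasurable
    (hY.2.1.mono fun _ hω => Real.rpow_nonneg hω _)).1
    ((lintegral_rpow_le_maxMoment hB hY).trans_lt ENNReal.coe_lt_top).ne

lemma integral_rpow_le_maxMoment (hB : IsBrownianReal B P) (hY : Y ∈ returns M P B) :
    ∫ ω, Y ω ^ M.α ∂P ≤ M.maxMoment := by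
  rw [← ENNReal.ofReal_le_ofReal_iff M.maxMoment.coe_nonneg, ENNReal.ofReal_coe_nnreal,
    ofReal_integral_eq_lintegral_ofReal (integrable_rpow_of_mem_returns hB hY)
    (hY.2.1.mono fun _ hω => Real.rpow_nonneg hω _)]
  exact lintegral_rpow_le_maxMoment hB hY

end Returns

section ValueFunction

variable {Ω : Type*} [MeasurableSpace Ω] {P : Measure Ω} [IsProbabilityMeasure P]
  {B : ℝ≥0 → Ω → ℝ} {M : Model} {Y : Ω → ℝ} {θ : ℝ}

lemma integrable_F_of_integrable_rpow (hY : AEMeasurable Y P) (h0 : ∀ᵐ ω ∂P, 0 ≤ Y ω)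
    (hint : Integrable (fun ω => Y ω ^ M.α) P) (θ : ℝ) : Integrable (fun ω => M.F (Y ω) θ) P := by
  refine Integrable.add ?_ (hint.const_mul θ)
  refine Integrable.mono' (hint.add (integrable_const (M.k * M.γ ^ M.α)))
    (M.continuous_U.measurable.comp_aemeasurable (hY.sub_const _)).aestronglyMeasurable ?_
  filter_upwards [h0] with ω hω
  have hloss := mul_nonneg M.k_nonneg (Real.rpow_nonneg M.γ_pos.le M.α)
  have hpow := Real.rpow_nonneg hω M.α
  rw [Real.norm_eq_abs, abs_le, Pi.add_apply]
  constructor <;> linarith [M.U_sub_le_rpow hω, M.le_U_sub hω]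

variable [P.IsComplete]

lemma integrable_F_of_mem_returns (hB : IsBrownianReal B P) (hY : Y ∈ returns M P B) (θ : ℝ) :
    Integrable (fun ω => M.F (Y ω) θ) P :=
  integrable_F_of_integrable_rpow (measurable_of_mem_returns hB hY).aemeasurable hY.2.1
    (integrable_rpow_of_mem_returns hB hY) θ

lemma objective_eq_add (hB : IsBrownianReal B P) (hY : Y ∈ returns M P B) (θ θ' : ℝ) :
    objective M P θ' Y = objective M P θ Y + (∫ ω, Y ω ^ M.α ∂P) * (θ' - θ) := by
  simp_rw [objective, fun y => M.F_eq_add_sub y θ θ']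
  rw [integral_add (integrable_F_of_mem_returns hB hY θ)
    ((integrable_rpow_of_mem_returns hB hY).const_mul _), integral_const_mul, mul_comm (θ' - θ)]

lemma objective_le_of_mem_returns (hB : IsBrownianReal B P) (hY : Y ∈ returns M P B) (θ : ℝ) :
    objective M P θ Y ≤ M.maxMoment + M.maxMoment * |θ| := by
  have hmoment := integral_rpow_le_maxMoment hB hY
  have hmyopic : objective M P 0 Y ≤ ∫ ω, Y ω ^ M.α ∂P := by
    refine integral_mono_ae (integrable_F_of_mem_returns hB hY 0)
      (integrable_rpow_of_mem_returns hB hY) (hY.2.1.mono fun ω hω => ?_)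
    simpa only [M.F_zero_right] using M.U_sub_le_rpow hω
  have hslope : (∫ ω, Y ω ^ M.α ∂P) * θ ≤ M.maxMoment * |θ| :=
    (mul_le_mul_of_nonneg_left (le_abs_self θ) (integral_rpow_nonneg hY)).trans
      (mul_le_mul_of_nonneg_right hmoment (abs_nonneg θ))
  rw [objective_eq_add hB hY 0 θ, sub_zero]
  linarith

lemma objective_le_Phi (hB : IsBrownianReal B P) (hY : Y ∈ returns M P B) (θ : ℝ) :
    objective M P θ Y ≤ Phi M P B θ :=
  le_csSup ⟨_, forall_mem_image.2 fun _ hY => objective_le_of_mem_returns hB hY θ⟩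
    (mem_image_of_mem _ hY)

lemma neg_le_Phi (hB : IsBrownianReal B P) (θ : ℝ) : -(M.k * M.γ ^ M.α) ≤ Phi M P B θ := by
  simpa [objective, M.F_zero_left] using objective_le_Phi (M := M) hB zero_mem_returns θ

lemma lipschitzWith_Phi (hB : IsBrownianReal B P) : LipschitzWith M.maxMoment (Phi M P B) := by
  refine LipschitzWith.of_le_add_mul _ fun θ' θ => Phi_le fun Y hY => ?_
  have hslope : (∫ ω, Y ω ^ M.α ∂P) * (θ' - θ) ≤ M.maxMoment * dist θ' θ :=
    (mul_le_mul_of_nonneg_left (le_abs_self _) (integral_rpow_nonneg hY)).trans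
      (mul_le_mul_of_nonneg_right (integral_rpow_le_maxMoment hB hY) (abs_nonneg _))
  linarith [objective_eq_add hB hY θ θ', objective_le_Phi hB hY θ]

lemma convexOn_Phi (hB : IsBrownianReal B P) : ConvexOn ℝ univ (Phi M P B) := by
  refine ⟨convex_univ, fun θ _ θ' _ s t hs ht hst => Phi_le fun Y hY => ?_⟩
  have haff : objective M P (s • θ + t • θ') Y =
      s * objective M P θ Y + t * objective M P θ' Y := by
    rw [objective_eq_add hB hY 0 θ, objective_eq_add hB hY 0 θ',
      objective_eq_add hB hY 0 (s • θ + t • θ'), smul_eq_mul, smul_eq_mul]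
    linear_combination (-objective M P 0 Y) * hst
  rw [haff]
  exact add_le_add (mul_le_mul_of_nonneg_left (objective_le_Phi hB hY θ) hs)
    (mul_le_mul_of_nonneg_left (objective_le_Phi hB hY θ') ht)

lemma isSubgradient_of_mem_maximizers (hB : IsBrownianReal B P) (hY : Y ∈ maximizers M P B θ) :
    IsSubgradient (Phi M P B) θ (∫ ω, Y ω ^ M.α ∂P) := fun θ' => by
  have hmax : Phi M P B θ ≤ objective M P θ Y := Phi_le fun Y' hY' => hY.2 hY'
  linarith [objective_le_Phi hB hY.1 θ', objective_eq_add hB hY.1 θ θ']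

end ValueFunction

section Duality

variable {Ω : Type*} [MeasurableSpace Ω] {P : Measure Ω} {B : ℝ≥0 → Ω → ℝ} {M : Model}
  {θ θ' c c' s : ℝ} {u v : Ω → ℝ}

/-- The Kuhn-Tucker conditions for the portfolio problem `sup E[F(Y; θ)]` at the return `v`, with
the multiplier `c` of the budget constraint. -/
structure IsKuhnTucker (M : Model) (P : Measure Ω) (B : ℝ≥0 → Ω → ℝ) (θ c : ℝ) (v : Ω → ℝ) :
    Prop where
  mem_returns : v ∈ returns M P B
  mem_demandSet : ∀ ω, v ω ∈ demandSet (Ici 0) (M.F · θ) (c * periodKernel M B ω)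
  mul_integral_eq : c * ∫ ω, periodKernel M B ω * v ω ∂P = c

section WeakDuality

variable [IsProbabilityMeasure P] [P.IsComplete]

lemma integral_F_sub_eq (hB : IsBrownianReal B P) (hv : v ∈ returns M P B) (θ c : ℝ) :
    ∫ ω, (M.F (v ω) θ - c * (periodKernel M B ω * v ω)) ∂P =
      objective M P θ v - c * ∫ ω, periodKernel M B ω * v ω ∂P := by
  rw [integral_sub (integrable_F_of_mem_returns hB hv θ)
    ((integrable_mul_of_mem_returns hB hv).const_mul c), integral_const_mul, objective]

lemma Phi_le_integral_F_sub_add (hB : IsBrownianReal B P) (hc : 0 ≤ c)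
    (hu : ∀ ω, u ω ∈ demandSet (Ici 0) (M.F · θ) (c * periodKernel M B ω))
    (hint : Integrable (fun ω => M.F (u ω) θ - c * (periodKernel M B ω * u ω)) P) :
    Phi M P B θ ≤ ∫ ω, (M.F (u ω) θ - c * (periodKernel M B ω * u ω)) ∂P + c := by
  refine Phi_le fun Y hY => ?_
  have hle : ∫ ω, (M.F (Y ω) θ - c * (periodKernel M B ω * Y ω)) ∂P ≤
      ∫ ω, (M.F (u ω) θ - c * (periodKernel M B ω * u ω)) ∂P := by
    refine integral_mono_ae ((integrable_F_of_mem_returns hB hY θ).sub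
      ((integrable_mul_of_mem_returns hB hY).const_mul c)) hint ?_
    filter_upwards [hY.2.1] with ω hω
    simpa only [mul_assoc] using (hu ω).2 (Y ω) hω
  rw [integral_F_sub_eq hB hY] at hle
  linarith [mul_le_mul_of_nonneg_left (integral_mul_le_of_mem_returns hB hY) hc]

namespace IsKuhnTucker

lemma mem_maximizers (hv : IsKuhnTucker M P B θ c v) (hB : IsBrownianReal B P) (hc : 0 ≤ c) :
    v ∈ maximizers M P B θ := by
  have hle := Phi_le_integral_F_sub_add hB hc hv.mem_demandSet <|
    (integrable_F_of_mem_returns hB hv.mem_returns θ).sub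
      ((integrable_mul_of_mem_returns hB hv.mem_returns).const_mul c)
  rw [integral_F_sub_eq hB hv.mem_returns, hv.mul_integral_eq, sub_add_cancel] at hle
  exact ⟨hv.mem_returns, fun Y hY => (objective_le_Phi hB hY θ).trans hle⟩

/-- Testing the dual problem at `(θ', c')` with its pointwise optimum `u`, which `v` beats at
`(θ, c)`. -/
lemma Phi_le (hv : IsKuhnTucker M P B θ c v) (hB : IsBrownianReal B P) (hc' : 0 ≤ c')
    (hu : ∀ ω, u ω ∈ demandSet (Ici 0) (M.F · θ') (c' * periodKernel M B ω))
    (hu_int : Integrable u P) (hZu : Integrable (fun ω => periodKernel M B ω * u ω) P) :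
    Phi M P B θ' ≤ Phi M P B θ + (∫ ω, u ω ^ M.α ∂P) * (θ' - θ) +
      (c' - c) * (1 - ∫ ω, periodKernel M B ω * u ω ∂P) := by
  have hu0 : ∀ ω, 0 ≤ u ω := fun ω => (hu ω).1
  have hpow := integrable_rpow_of_integrable ⟨M.α_pos.le, M.α_lt_one.le⟩ hu_int hu0
  have hLu : Integrable (fun ω => M.F (u ω) θ' - c' * (periodKernel M B ω * u ω)) P :=
    (integrable_F_of_integrable_rpow hu_int.aemeasurable (Eventually.of_forall hu0) hpow θ').sub
      (hZu.const_mul c')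
  have hLv : Integrable (fun ω => M.F (v ω) θ - c * (periodKernel M B ω * v ω)) P :=
    (integrable_F_of_mem_returns hB hv.mem_returns θ).sub
      ((integrable_mul_of_mem_returns hB hv.mem_returns).const_mul c)
  have hpow' := hpow.mul_const (θ' - θ)
  have hZu' := hZu.const_mul (c' - c)
  have hcorr : Integrable (fun ω => u ω ^ M.α * (θ' - θ) -
      (c' - c) * (periodKernel M B ω * u ω)) P := hpow'.sub hZu'
  have hle : ∫ ω, (M.F (u ω) θ' - c' * (periodKernel M B ω * u ω)) ∂P ≤
      ∫ ω, ((M.F (v ω) θ - c * (periodKernel M B ω * v ω)) +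
        (u ω ^ M.α * (θ' - θ) - (c' - c) * (periodKernel M B ω * u ω))) ∂P := by
    refine integral_mono hLu (hLv.add hcorr) fun ω => ?_
    have hmax := (hv.mem_demandSet ω).2 (u ω) (hu0 ω)
    simp only [M.F_eq_add_sub (u ω) θ θ']
    linarith
  rw [integral_add hLv hcorr, integral_sub hpow' hZu', integral_mul_const,
    integral_const_mul, integral_F_sub_eq hB hv.mem_returns, hv.mul_integral_eq] at hle
  linarith [Phi_le_integral_F_sub_add hB hc' hu hLu, objective_le_Phi hB hv.mem_returns θ]

end IsKuhnTucker

end WeakDuality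

/-- The return chosen state by state by an agent who can buy wealth at the multiple `c` of the
state price. -/
noncomputable def demandedReturn (M : Model) (B : ℝ≥0 → Ω → ℝ) (θ c : ℝ) (ω : Ω) : ℝ :=
  demand (Ici 0) (M.F · θ) (c * periodKernel M B ω)

omit [MeasurableSpace Ω] in
lemma demandedReturn_mem (hc : 0 < c) (ω : Ω) :
    demandedReturn M B θ c ω ∈ demandSet (Ici 0) (M.F · θ) (c * periodKernel M B ω) :=
  M.demand_F_mem (mul_pos hc (pricingKernel_pos ω)) θ

omit [MeasurableSpace Ω] in
lemma demandedReturn_mem_Icc {T : ℝ} (hc : 0 < c) (hθ : θ ≤ T) (hT : 0 ≤ T) (ω : Ω) :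
    demandedReturn M B θ c ω ∈
      Icc 0 (growthBound M.α (M.demandScale T / c / periodKernel M B ω)) := by
  rw [div_div]
  exact ⟨(demandedReturn_mem hc ω).1, M.le_growthBound_of_mem_demandSet
    (mul_pos hc (pricingKernel_pos ω)) hθ hT (demandedReturn_mem hc ω)⟩

lemma measurable_augmentedSigma_demandedReturn (hB : IsBrownianReal B P) (hc : 0 < c) :
    Measurable[augmentedSigma P B M.τ.toNNReal] (demandedReturn M B θ c) :=
  measurable_comp_of_antitoneOn (M.antitoneOn_demand_F θ)
    ((measurable_augmentedSigma_pricingKernel hB _).const_mul c)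
    fun ω => mul_pos hc (pricingKernel_pos ω)

lemma measurable_demandedReturn [P.IsComplete] (hB : IsBrownianReal B P) (hc : 0 < c) :
    Measurable (demandedReturn M B θ c) :=
  (measurable_augmentedSigma_demandedReturn hB hc).mono (augmentedSigma_le hB _) le_rfl

lemma integrable_demandedReturn [P.IsComplete] (hB : IsBrownianReal B P) (hc : 0 < c) :
    Integrable (demandedReturn M B θ c) P := by
  have hZ := isStatePrice_periodKernel (M := M) hB
  have hscale := M.demandScale_nonneg (abs_nonneg θ)
  refine Integrable.mono' (hZ.integrable_growthBound (α := M.α) (div_nonneg hscale hc.le))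
    (measurable_demandedReturn hB hc).aestronglyMeasurable (Eventually.of_forall fun ω => ?_)
  have hmem := demandedReturn_mem_Icc (M := M) (B := B) hc (le_abs_self θ) (abs_nonneg θ) ω
  rw [Real.norm_of_nonneg hmem.1]
  exact hmem.2

lemma integrable_mul_demandedReturn [P.IsComplete] (hB : IsBrownianReal B P) (hc : 0 < c) :
    Integrable (fun ω => periodKernel M B ω * demandedReturn M B θ c ω) P := by
  have hZ := isStatePrice_periodKernel (M := M) hB
  have hscale := M.demandScale_nonneg (abs_nonneg θ)
  refine Integrable.mono' (hZ.integrable_mul_growthBound (α := M.α) (div_nonneg hscale hc.le))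
    (hZ.measurable.mul (measurable_demandedReturn hB hc)).aestronglyMeasurable
    (Eventually.of_forall fun ω => ?_)
  have hmem := demandedReturn_mem_Icc (M := M) (B := B) hc (le_abs_self θ) (abs_nonneg θ) ω
  rw [Real.norm_of_nonneg (mul_nonneg (hZ.pos ω).le hmem.1)]
  exact mul_le_mul_of_nonneg_left hmem.2 (hZ.pos ω).le

lemma ae_demandSet_subset_singleton [P.IsComplete] (hB : IsBrownianReal B P) (hc : 0 < c) :
    ∀ᵐ ω ∂P, demandSet (Ici 0) (M.F · θ) (c * periodKernel M B ω) ⊆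
      {demandedReturn M B θ c ω} := by
  have hcount := countable_not_subset_singleton_demandSet subset_rfl
    fun p hp => M.demand_F_mem hp θ
  filter_upwards [(isStatePrice_periodKernel hB).ae_mul_notMem hcount hc.ne'] with ω hω
  by_contra h
  exact hω ⟨mul_pos hc (pricingKernel_pos ω), h⟩

lemma tendsto_integral_demandedReturn_rpow [IsProbabilityMeasure P] [P.IsComplete]
    (hB : IsBrownianReal B P) (hc : 0 < c) :
    Tendsto (fun θ' => ∫ ω, demandedReturn M B θ' c ω ^ M.α ∂P) (𝓝 θ)
      (𝓝 (∫ ω, demandedReturn M B θ c ω ^ M.α ∂P)) := by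
  have hT : 0 ≤ |θ| + 1 := by positivity
  have hnear : ∀ᶠ θ' in 𝓝 θ, θ' ≤ |θ| + 1 :=
    (eventually_lt_nhds (by linarith [le_abs_self θ])).mono fun _ h => le_of_lt h
  refine tendsto_integral_rpow ⟨M.α_pos.le, M.α_lt_one.le⟩
    ((isStatePrice_periodKernel hB).integrable_growthBound (α := M.α)
      (div_nonneg (M.demandScale_nonneg hT) hc.le))
    (Eventually.of_forall fun θ' => measurable_demandedReturn hB hc)
    (hnear.mono fun θ' hθ' => demandedReturn_mem_Icc hc hθ' hT) ?_
  filter_upwards [ae_demandSet_subset_singleton hB hc] with ω hω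
  exact tendsto_of_mem_demandSet_of_subset_singleton isClosed_Ici M.continuous_F
    tendsto_const_nhds tendsto_id (hnear.mono fun θ' hθ' => demandedReturn_mem_Icc hc hθ' hT ω)
    (Eventually.of_forall fun θ' => demandedReturn_mem hc ω) hω

lemma exists_maximizer_of_binding [IsProbabilityMeasure P] [P.IsComplete]
    (hB : IsBrownianReal B P) (hs : IsSubgradient (Phi M P B) θ s) (hc : 0 < c)
    (hcost : ∫ ω, periodKernel M B ω * demandedReturn M B θ c ω ∂P = 1) :
    ∃ Y ∈ maximizers M P B θ, ∫ ω, Y ω ^ M.α ∂P = s := by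
  have hv : IsKuhnTucker M P B θ c (demandedReturn M B θ c) :=
    ⟨mem_returns_of_integral_le (measurable_augmentedSigma_demandedReturn hB hc)
      (fun ω => (demandedReturn_mem hc ω).1) (integrable_mul_demandedReturn hB hc) hcost.le,
      demandedReturn_mem hc, by rw [hcost, mul_one]⟩
  have hle : ∀ θ', Phi M P B θ' ≤
      Phi M P B θ + (∫ ω, demandedReturn M B θ' c ω ^ M.α ∂P) * (θ' - θ) := fun θ' => by
    simpa using hv.Phi_le hB hc.le (demandedReturn_mem hc)
      (integrable_demandedReturn (θ := θ') hB hc) (integrable_mul_demandedReturn hB hc)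
  have hlim := tendsto_integral_demandedReturn_rpow (M := M) (θ := θ) hB hc
  refine ⟨_, hv.mem_maximizers hB hc.le, le_antisymm ?_ ?_⟩
  · exact hs.ge_of_tendsto (hlim.mono_left nhdsWithin_le_nhds) (Eventually.of_forall hle)
  · exact hs.le_of_tendsto (hlim.mono_left nhdsWithin_le_nhds) (Eventually.of_forall hle)

end Duality

section SlackBudget

variable {Ω : Type*} [MeasurableSpace Ω] {P : Measure Ω} {B : ℝ≥0 → Ω → ℝ} {M : Model}
  {θ s c μ : ℝ} {v : Ω → ℝ}

lemma isKuhnTucker_zero (hv : v ∈ returns M P B) (hmem : ∀ ω, v ω ∈ M.satiationSet θ) :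
    IsKuhnTucker M P B θ 0 v :=
  ⟨hv, fun ω => by
    rw [zero_mul]
    exact hmem ω, zero_mul _⟩

/-- The return chosen state by state from the satiation points of `F(·; θ)` by an agent with utility
`y ^ α` who can buy wealth at the multiple `μ` of the state price. -/
noncomputable def satiatedReturn (M : Model) (B : ℝ≥0 → Ω → ℝ) (θ μ : ℝ) (ω : Ω) : ℝ :=
  M.satiatedDemand θ (μ * periodKernel M B ω)

lemma measurable_augmentedSigma_satiatedReturn (hB : IsBrownianReal B P) (hθ : θ < -1)
    (hμ : 0 < μ) : Measurable[augmentedSigma P B M.τ.toNNReal] (satiatedReturn M B θ μ) :=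
  measurable_comp_of_antitoneOn (M.antitoneOn_satiatedDemand hθ)
    ((measurable_augmentedSigma_pricingKernel hB _).const_mul μ)
    fun ω => mul_pos hμ (pricingKernel_pos ω)

variable [P.IsComplete]

lemma isKuhnTucker_const {y : ℝ} (hB : IsBrownianReal B P) (hy : y ∈ M.satiationSet θ)
    (hcost : ∫ ω, periodKernel M B ω * y ∂P ≤ 1) : IsKuhnTucker M P B θ 0 fun _ => y :=
  isKuhnTucker_zero (mem_returns_of_integral_le measurable_const (fun _ => hy.1)
    ((isStatePrice_periodKernel hB).integrable.mul_const y) hcost) fun _ => hy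

lemma measurable_satiatedReturn (hB : IsBrownianReal B P) (hθ : θ < -1) (hμ : 0 < μ) :
    Measurable (satiatedReturn M B θ μ) :=
  (measurable_augmentedSigma_satiatedReturn hB hθ hμ).mono (augmentedSigma_le hB _) le_rfl

lemma integrable_mul_satiatedReturn (hB : IsBrownianReal B P) (hθ : θ < -1) (hμ : 0 < μ) :
    Integrable (fun ω => periodKernel M B ω * satiatedReturn M B θ μ ω) P := by
  refine (isStatePrice_periodKernel hB).integrable.mul_bdd (c := M.satiationBound θ)
    (measurable_satiatedReturn hB hθ hμ).aestronglyMeasurable (Eventually.of_forall fun ω => ?_)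
  have hmem := M.satiatedDemand_mem_Icc hθ (μ * periodKernel M B ω)
  rw [satiatedReturn, Real.norm_of_nonneg hmem.1]
  exact hmem.2

lemma ae_tendsto_demandedReturn_satiatedReturn (hB : IsBrownianReal B P) (hθ : θ < -1)
    (hμ : 0 < μ) :
    ∀ᵐ ω ∂P, Tendsto (fun θ' => demandedReturn M B θ' ((θ' - θ) * μ) ω) (𝓝[>] θ)
      (𝓝 (satiatedReturn M B θ μ ω)) := by
  have hcount := countable_not_subset_singleton_demandSet
    ((M.satiationSet_subset_Icc hθ).trans Icc_subset_Ici_self) fun x _ => M.satiatedDemand_mem hθ x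
  filter_upwards [(isStatePrice_periodKernel hB).ae_mul_notMem hcount hμ.ne'] with ω hω
  have hx : 0 < μ * periodKernel M B ω := mul_pos hμ (pricingKernel_pos ω)
  have huniq : demandSet (M.satiationSet θ) (· ^ M.α) (μ * periodKernel M B ω) ⊆
      {satiatedReturn M B θ μ ω} := by
    by_contra h
    exact hω ⟨hx, h⟩
  simpa only [demandedReturn, satiatedReturn, mul_assoc] using
    M.tendsto_demand_satiatedDemand hθ hx huniq

lemma tendsto_integral_mul_demandedReturn_atTop (hB : IsBrownianReal B P) (θ : ℝ) :
    Tendsto (fun c => ∫ ω, periodKernel M B ω * demandedReturn M B θ c ω ∂P) atTop (𝓝 0) := by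
  have hD0 : ∀ p, 0 < p → 0 ≤ demand (Ici 0) (M.F · θ) p := fun p hp => (M.demand_F_mem hp θ).1
  have hlim : Tendsto (demand (Ici 0) (M.F · θ)) atTop (𝓝 0) := by
    refine tendsto_of_tendsto_of_tendsto_of_le_of_le' tendsto_const_nhds
      (tendsto_growthBound_div_atTop M.α_lt_one (M.demandScale |θ|)) ?_ ?_ <;>
    filter_upwards [eventually_gt_atTop 0] with p hp
    · exact hD0 p hp
    · exact M.le_growthBound_of_mem_demandSet hp (le_abs_self θ) (abs_nonneg θ)
        (M.demand_F_mem hp θ)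
  have h := (isStatePrice_periodKernel hB).tendsto_integral_mul_comp_atTop
    (M.antitoneOn_demand_F θ) hD0 hlim (fun ω => (pricingKernel_pos ω).le)
    fun c hc => integrable_mul_demandedReturn hB hc
  simp only [mul_zero, integral_zero] at h
  exact h

lemma exists_integral_mul_demandedReturn_eq_one_or_forall_lt (hB : IsBrownianReal B P) (θ : ℝ) :
    (∃ c, 0 < c ∧ ∫ ω, periodKernel M B ω * demandedReturn M B θ c ω ∂P = 1) ∨
      ∀ c, 0 < c → ∫ ω, periodKernel M B ω * demandedReturn M B θ c ω ∂P < 1 := by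
  have hcont := (isStatePrice_periodKernel hB).continuousOn_integral_mul_comp
    (M.antitoneOn_demand_F θ) (fun p hp => (M.demand_F_mem hp θ).1)
    (fun ω => (pricingKernel_pos ω).le) fun c hc => integrable_mul_demandedReturn hB hc
  rcases exists_eq_or_forall_lt_or_forall_gt hcont 1 with h | h | h
  · exact Or.inl h
  · exact Or.inr h
  · obtain ⟨c, hlt, hc⟩ := (((tendsto_integral_mul_demandedReturn_atTop hB θ).eventually_lt_const
      one_pos).and (eventually_gt_atTop 0)).exists
    exact absurd hlt (h c hc).not_gt

variable [IsProbabilityMeasure P]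

lemma exists_mem_satiationSet_of_forall_lt (hB : IsBrownianReal B P)
    (hcost : ∀ c, 0 < c → ∫ ω, periodKernel M B ω * demandedReturn M B θ c ω ∂P < 1) :
    ∃ y ∈ M.satiationSet θ, ∫ ω, periodKernel M B ω * y ∂P ≤ 1 := by
  have hZ := isStatePrice_periodKernel (M := M) hB
  have hD := M.antitoneOn_demand_F θ
  have hD0 : ∀ p, 0 < p → 0 ≤ demand (Ici 0) (M.F · θ) p := fun p hp => (M.demand_F_mem hp θ).1
  obtain ⟨R, hR⟩ := hZ.exists_forall_le_of_integral_mul_comp_le hD hD0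
    (fun c hc => integrable_mul_demandedReturn hB hc) fun c hc => (hcost c hc).le
  have hlim := hD.tendsto_nhdsGT ⟨R, forall_mem_image.2 hR⟩
  refine ⟨_, mem_demandSet_of_tendsto isClosed_Ici M.continuous_F
    (tendsto_id.mono_left nhdsWithin_le_nhds) tendsto_const_nhds hlim
    (eventually_nhdsWithin_of_forall fun p hp => M.demand_F_mem hp θ), ?_⟩
  refine le_of_tendsto (hZ.tendsto_integral_mul (l := 𝓝[>] 0)
    (eventually_nhdsWithin_of_forall fun c hc => measurable_demandedReturn (θ := θ) hB hc)
    (eventually_nhdsWithin_of_forall fun c hc ω => ⟨(demandedReturn_mem hc ω).1,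
      hR _ (mul_pos hc (hZ.pos ω))⟩)
    (Eventually.of_forall fun ω => hlim.comp (tendsto_mul_const_nhdsGT_zero (hZ.pos ω))))
    (eventually_nhdsWithin_of_forall fun c hc => (hcost c hc).le)

lemma IsKuhnTucker.le_integral_satiatedReturn_rpow_add (hv : IsKuhnTucker M P B θ 0 v)
    (hB : IsBrownianReal B P) (hs : IsSubgradient (Phi M P B) θ s) (hθ : θ < -1) (hμ : 0 < μ) :
    s ≤ ∫ ω, satiatedReturn M B θ μ ω ^ M.α ∂P +
      μ * (1 - ∫ ω, periodKernel M B ω * satiatedReturn M B θ μ ω ∂P) := by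
  have hZ := isStatePrice_periodKernel (M := M) hB
  have hT : (θ - 1) / 2 < -1 := by linarith
  have hnear : ∀ᶠ θ' in 𝓝[>] θ, 0 < (θ' - θ) * μ ∧ θ' ≤ (θ - 1) / 2 :=
    Filter.mem_of_superset (Ioc_mem_nhdsGT (by linarith : θ < (θ - 1) / 2))
      fun θ' h => ⟨mul_pos (sub_pos.2 h.1) hμ, h.2⟩
  set u : ℝ → Ω → ℝ := fun θ' => demandedReturn M B θ' ((θ' - θ) * μ)
  have hmeas : ∀ᶠ θ' in 𝓝[>] θ, Measurable (u θ') :=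
    hnear.mono fun θ' h => measurable_demandedReturn hB h.1
  have hu : ∀ᶠ θ' in 𝓝[>] θ, ∀ ω, u θ' ω ∈ Icc 0 (M.satiationBound ((θ - 1) / 2)) :=
    hnear.mono fun θ' h ω => ⟨(demandedReturn_mem h.1 ω).1, M.le_satiationBound_of_mem_demandSet
      (mul_pos h.1 (hZ.pos ω)).le h.2 hT (demandedReturn_mem h.1 ω)⟩
  have hlim := ae_tendsto_demandedReturn_satiatedReturn (M := M) hB hθ hμ
  have hmoment := tendsto_integral_rpow ⟨M.α_pos.le, M.α_lt_one.le⟩ (integrable_const _) hmeas hu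
    hlim
  have hcost := hZ.tendsto_integral_mul hmeas hu hlim
  refine hs.le_of_tendsto (hmoment.add ((hcost.const_sub 1).const_mul μ)) (hnear.mono ?_)
  intro θ' h
  refine (hv.Phi_le (θ' := θ') (u := u θ') hB h.1.le (demandedReturn_mem h.1)
    (integrable_demandedReturn hB h.1) (integrable_mul_demandedReturn hB h.1)).trans_eq ?_
  ring

lemma IsKuhnTucker.demand_zero_rpow_le (hv : IsKuhnTucker M P B θ 0 v)
    (hB : IsBrownianReal B P) (hs : IsSubgradient (Phi M P B) θ s) (hθ : θ < -1) :
    demand (Ici 0) (M.F · θ) 0 ^ M.α ≤ s := by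
  refine hs.ge_of_tendsto ((M.tendsto_demand_zero hθ).rpow_const (Or.inr M.α_pos.le)) ?_
  filter_upwards [self_mem_nhdsWithin] with θ' (hθ' : θ' < θ)
  have hmem : demand (Ici 0) (M.F · θ') 0 ∈ demandSet (Ici 0) (M.F · θ') 0 :=
    M.demand_zero_mem_satiationSet (hθ'.trans hθ)
  simpa using hv.Phi_le hB le_rfl (fun ω => by simpa only [zero_mul] using hmem)
    (integrable_const _) ((isStatePrice_periodKernel hB).integrable.mul_const _)

lemma tendsto_integral_satiatedReturn_rpow {ι : Type*} {l : Filter ι} [l.IsCountablyGenerated]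
    {m : ι → ℝ} {y : ℝ} (hB : IsBrownianReal B P) (hθ : θ < -1) (hm : ∀ᶠ i in l, 0 < m i)
    (hlim : ∀ ω, Tendsto (fun i => satiatedReturn M B θ (m i) ω) l (𝓝 y)) :
    Tendsto (fun i => ∫ ω, satiatedReturn M B θ (m i) ω ^ M.α ∂P) l (𝓝 (y ^ M.α)) := by
  simpa using tendsto_integral_rpow (P := P) ⟨M.α_pos.le, M.α_lt_one.le⟩
    (integrable_const (M.satiationBound θ))
    (hm.mono fun i hi => measurable_satiatedReturn hB hθ hi)
    (Eventually.of_forall fun i ω => M.satiatedDemand_mem_Icc hθ _) (Eventually.of_forall hlim)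

lemma exists_maximizer_of_integral_satiatedReturn_rpow_eq (hv : IsKuhnTucker M P B θ 0 v)
    (hB : IsBrownianReal B P) (hs : IsSubgradient (Phi M P B) θ s) (hθ : θ < -1) (hμ : 0 < μ)
    (hmoment : ∫ ω, satiatedReturn M B θ μ ω ^ M.α ∂P = s) :
    ∃ Y ∈ maximizers M P B θ, ∫ ω, Y ω ^ M.α ∂P = s := by
  have hle := hv.le_integral_satiatedReturn_rpow_add hB hs hθ hμ
  rw [hmoment, le_add_iff_nonneg_right] at hle
  have hcost := sub_nonneg.1 (nonneg_of_mul_nonneg_right hle hμ)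
  have hmem : ∀ ω, satiatedReturn M B θ μ ω ∈ M.satiationSet θ :=
    fun ω => (M.satiatedDemand_mem hθ _).1
  have hret := mem_returns_of_integral_le (measurable_augmentedSigma_satiatedReturn hB hθ hμ)
    (fun ω => (hmem ω).1) (integrable_mul_satiatedReturn hB hθ hμ) hcost
  exact ⟨_, (isKuhnTucker_zero hret hmem).mem_maximizers hB le_rfl, hmoment⟩

lemma exists_maximizer_of_forall_lt (hv : IsKuhnTucker M P B θ 0 v)
    (hB : IsBrownianReal B P) (hs : IsSubgradient (Phi M P B) θ s) (hθ : θ < -1)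
    (hlt : ∀ μ, 0 < μ → ∫ ω, satiatedReturn M B θ μ ω ^ M.α ∂P < s) :
    ∃ Y ∈ maximizers M P B θ, ∫ ω, Y ω ^ M.α ∂P = s := by
  have hZ := isStatePrice_periodKernel (M := M) hB
  obtain ⟨y, hy⟩ := (M.isCompact_satiationSet hθ).exists_isGreatest (M.satiationSet_nonempty hθ)
  have hlim : ∀ ω, Tendsto (fun μ => satiatedReturn M B θ μ ω) (𝓝[>] 0) (𝓝 y) := fun ω =>
    (M.tendsto_satiatedDemand_zero hθ hy).comp (tendsto_mul_const_nhdsGT_zero (hZ.pos ω))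
  have hpos : ∀ᶠ μ : ℝ in 𝓝[>] 0, 0 < μ := self_mem_nhdsWithin
  have hdual : ∀ᶠ μ in 𝓝[>] 0, s ≤ ∫ ω, satiatedReturn M B θ μ ω ^ M.α ∂P +
      μ * (1 - ∫ ω, periodKernel M B ω * satiatedReturn M B θ μ ω ∂P) :=
    hpos.mono fun μ hμ => hv.le_integral_satiatedReturn_rpow_add hB hs hθ hμ
  have hmoment := tendsto_integral_satiatedReturn_rpow hB hθ hpos hlim
  have hcost := hZ.tendsto_integral_mul
    (hpos.mono fun μ hμ => measurable_satiatedReturn hB hθ hμ)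
    (Eventually.of_forall fun μ ω => M.satiatedDemand_mem_Icc hθ _) (Eventually.of_forall hlim)
  have hafford : ∫ ω, periodKernel M B ω * y ∂P ≤ 1 := by
    refine le_of_tendsto hcost ((hpos.and hdual).mono fun μ h => ?_)
    have hprod : 0 < μ * (1 - ∫ ω, periodKernel M B ω * satiatedReturn M B θ μ ω ∂P) := by
      linarith [hlt μ h.1, h.2]
    exact (sub_pos.1 (pos_of_mul_pos_right hprod h.1.le)).le
  have hle : y ^ M.α ≤ s := le_of_tendsto hmoment (hpos.mono fun μ hμ => (hlt μ hμ).le)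
  have hge : s ≤ y ^ M.α := by
    simpa using ge_of_tendsto (hmoment.add ((tendsto_id.mono_left nhdsWithin_le_nhds).mul
      (hcost.const_sub 1))) hdual
  exact ⟨_, (isKuhnTucker_const hB hy.1 hafford).mem_maximizers hB le_rfl,
    by simpa using le_antisymm hle hge⟩

lemma exists_maximizer_of_forall_gt {y : ℝ} (hB : IsBrownianReal B P)
    (hs : IsSubgradient (Phi M P B) θ s) (hθ : θ < -1) (hy : y ∈ M.satiationSet θ)
    (hafford : ∫ ω, periodKernel M B ω * y ∂P ≤ 1)
    (hgt : ∀ μ, 0 < μ → s < ∫ ω, satiatedReturn M B θ μ ω ^ M.α ∂P) :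
    ∃ Y ∈ maximizers M P B θ, ∫ ω, Y ω ^ M.α ∂P = s := by
  have hZ := isStatePrice_periodKernel (M := M) hB
  set y₀ := demand (Ici 0) (M.F · θ) 0
  have hy₀ : IsLeast (M.satiationSet θ) y₀ :=
    ⟨M.demand_zero_mem_satiationSet hθ, fun z hz => demand_le subset_rfl hz⟩
  have hafford₀ : ∫ ω, periodKernel M B ω * y₀ ∂P ≤ 1 :=
    (integral_mono (hZ.integrable.mul_const y₀) (hZ.integrable.mul_const y) fun ω =>
      mul_le_mul_of_nonneg_left (hy₀.2 hy) (hZ.pos ω).le).trans hafford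
  have hv := isKuhnTucker_const hB hy₀.1 hafford₀
  have hpos := eventually_gt_atTop (0 : ℝ)
  have hge : s ≤ y₀ ^ M.α := ge_of_tendsto (tendsto_integral_satiatedReturn_rpow hB hθ hpos
    fun ω => (M.tendsto_satiatedDemand_atTop hθ hy₀).comp (tendsto_id.atTop_mul_const (hZ.pos ω)))
    (hpos.mono fun μ hμ => (hgt μ hμ).le)
  exact ⟨_, hv.mem_maximizers hB le_rfl,
    by simpa using le_antisymm (hv.demand_zero_rpow_le hB hs hθ) hge⟩

lemma continuousOn_integral_satiatedReturn_rpow (hB : IsBrownianReal B P) (hθ : θ < -1) :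
    ContinuousOn (fun μ => ∫ ω, satiatedReturn M B θ μ ω ^ M.α ∂P) (Ioi 0) := by
  have h0 : ∀ x, 0 ≤ M.satiatedDemand θ x := fun x => (M.satiatedDemand_mem_Icc hθ x).1
  have hanti : AntitoneOn (fun x => M.satiatedDemand θ x ^ M.α) (Ioi 0) := fun x hx x' hx' h =>
    Real.rpow_le_rpow (h0 x') (M.antitoneOn_satiatedDemand hθ hx hx' h) M.α_pos.le
  have hint : ∀ μ, 0 < μ → Integrable (fun ω => satiatedReturn M B θ μ ω ^ M.α) P := fun μ hμ =>
    integrable_rpow_of_integrable ⟨M.α_pos.le, M.α_lt_one.le⟩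
      (.of_mem_Icc _ _ (measurable_satiatedReturn hB hθ hμ).aemeasurable
        (Eventually.of_forall fun ω => M.satiatedDemand_mem_Icc hθ _)) fun ω => h0 _
  have hcont := (isStatePrice_periodKernel hB).continuousOn_integral_mul_comp hanti
    (fun x _ => Real.rpow_nonneg (h0 x) _) (fun _ => zero_le_one)
    (by simpa only [one_mul, satiatedReturn] using hint)
  simp only [one_mul] at hcont
  exact hcont

lemma exists_maximizer_of_slack {y : ℝ} (hB : IsBrownianReal B P)
    (hs : IsSubgradient (Phi M P B) θ s) (hθ : θ < -1) (hy : y ∈ M.satiationSet θ)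
    (hafford : ∫ ω, periodKernel M B ω * y ∂P ≤ 1) :
    ∃ Y ∈ maximizers M P B θ, ∫ ω, Y ω ^ M.α ∂P = s := by
  have hv := isKuhnTucker_const hB hy hafford
  rcases exists_eq_or_forall_lt_or_forall_gt
    (continuousOn_integral_satiatedReturn_rpow (M := M) hB hθ) s with ⟨μ, hμ, heq⟩ | hlt | hgt
  · exact exists_maximizer_of_integral_satiatedReturn_rpow_eq hv hB hs hθ hμ heq
  · exact exists_maximizer_of_forall_lt hv hB hs hθ hlt
  · exact exists_maximizer_of_forall_gt hB hs hθ hy hafford hgt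

theorem exists_maximizer_of_isSubgradient (hB : IsBrownianReal B P)
    (hs : IsSubgradient (Phi M P B) θ s) (hθ : -1 < θ ∨ 0 < M.k) :
    ∃ Y ∈ maximizers M P B θ, ∫ ω, Y ω ^ M.α ∂P = s := by
  rcases exists_integral_mul_demandedReturn_eq_one_or_forall_lt (M := M) hB θ with
    ⟨c, hc, hcost⟩ | hcost
  · exact exists_maximizer_of_binding hB hs hc hcost
  · obtain ⟨y, hy, hafford⟩ := exists_mem_satiationSet_of_forall_lt hB hcost
    exact exists_maximizer_of_slack hB hs (M.lt_neg_one_of_mem_demandSet_zero hθ hy) hy hafford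

end SlackBudget

section Sophisticated

namespace Model

variable (M : Model) {β ξ : ℝ}

lemma disc_pos : 0 < M.disc := Real.exp_pos _

lemma disc_mul_maxMoment_lt_one : M.disc * M.maxMoment < 1 := by
  have h : M.h < M.δ := M.well_posed
  change M.disc * Real.exp (M.h * M.τ) < 1
  rw [disc, ← Real.exp_add, Real.exp_lt_one_iff]
  nlinarith [M.τ_pos]

lemma le_one_sub_disc_mul (hβ : β ≤ 1) (hξ : ξ ≤ M.maxMoment) :
    β ≤ 1 - (1 - β) * M.disc * ξ := by
  have hdisc : M.disc * ξ < 1 :=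
    (mul_le_mul_of_nonneg_left hξ M.disc_pos.le).trans_lt M.disc_mul_maxMoment_lt_one
  linarith [mul_nonneg (sub_nonneg.2 hβ) (sub_nonneg.2 hdisc.le)]

lemma weight_mem_Ioc (hβ : β ∈ Ioc (0 : ℝ) 1) (hξ : ξ ≤ M.maxMoment) :
    M.weight β ξ ∈ Ioc (0 : ℝ) 1 := by
  have hle := M.le_one_sub_disc_mul hβ.2 hξ
  have hpos := hβ.1.trans_le hle
  exact ⟨div_pos hβ.1 hpos, (div_le_one hpos).2 hle⟩

end Model

variable {Ω : Type*} [MeasurableSpace Ω] {P : Measure Ω} [IsProbabilityMeasure P] [P.IsComplete]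
  {B : ℝ≥0 → Ω → ℝ} {M : Model} {β β₁ β₂ ξ ξ₁ ξ₂ κ θ : ℝ}

lemma contractingWith_mul_Phi (hB : IsBrownianReal B P) (hκ : κ ∈ Icc (0 : ℝ) 1) :
    ContractingWith (M.disc * M.maxMoment).toNNReal fun θ => M.disc * Phi M P B (κ * θ) :=
  contractingWith_mul_comp (lipschitzWith_Phi hB) M.disc_pos.le M.disc_mul_maxMoment_lt_one hκ

lemma thetaStar_eq (hB : IsBrownianReal B P) (hκ : κ ∈ Icc (0 : ℝ) 1) :
    thetaStar M P B κ = M.disc * Phi M P B (κ * thetaStar M P B κ) :=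
  Classical.epsilon_spec (p := fun θ => θ = M.disc * Phi M P B (κ * θ))
    ⟨_, (contractingWith_mul_Phi hB hκ).fixedPoint_isFixedPt.symm⟩

lemma eq_thetaStar (hB : IsBrownianReal B P) (hκ : κ ∈ Icc (0 : ℝ) 1)
    (hθ : θ = M.disc * Phi M P B (κ * θ)) : θ = thetaStar M P B κ :=
  (contractingWith_mul_Phi hB hκ).fixedPoint_unique' hθ.symm (thetaStar_eq hB hκ).symm

lemma thetaStar_mul_AMy_pos (hB : IsBrownianReal B P) (hκ : κ ∈ Icc (0 : ℝ) 1)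
    (h : AMy M P B ≠ 0) : 0 < thetaStar M P B κ * AMy M P B := by
  rw [AMy_eq] at h ⊢
  rw [mul_left_comm]
  exact mul_pos M.disc_pos <| mul_pos_of_eq_mul_comp (lipschitzWith_Phi hB) M.disc_pos
    M.disc_mul_maxMoment_lt_one hκ (thetaStar_eq hB hκ) (right_ne_zero_of_mul h)

lemma thetaStar_pos (hB : IsBrownianReal B P) (hκ : κ ∈ Icc (0 : ℝ) 1) (h : 0 < AMy M P B) :
    0 < thetaStar M P B κ :=
  pos_of_mul_pos_left (thetaStar_mul_AMy_pos hB hκ h.ne') h.le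

lemma thetaStar_neg (hB : IsBrownianReal B P) (hκ : κ ∈ Icc (0 : ℝ) 1) (h : AMy M P B < 0) :
    thetaStar M P B κ < 0 :=
  neg_of_mul_pos_left (thetaStar_mul_AMy_pos hB hκ h.ne) h.le

lemma ASo_pos (hB : IsBrownianReal B P) (hβ : β ∈ Ioc (0 : ℝ) 1) (hξ : ξ ≤ M.maxMoment)
    (h : 0 < AMy M P B) : 0 < ASo M P B β ξ :=
  have hκ := M.weight_mem_Ioc hβ hξ
  mul_pos hκ.1 (thetaStar_pos hB (Ioc_subset_Icc_self hκ) h)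

lemma ASo_neg (hB : IsBrownianReal B P) (hβ : β ∈ Ioc (0 : ℝ) 1) (hξ : ξ ≤ M.maxMoment)
    (h : AMy M P B < 0) : ASo M P B β ξ < 0 :=
  have hκ := M.weight_mem_Ioc hβ hξ
  mul_neg_of_pos_of_neg hκ.1 (thetaStar_neg hB (Ioc_subset_Icc_self hκ) h)

lemma ASo_eq_iff (hB : IsBrownianReal B P) (hβ : β ∈ Ioc (0 : ℝ) 1) (hξ : ξ ≤ M.maxMoment) :
    ASo M P B β ξ = θ ↔ θ * (1 - (1 - β) * M.disc * ξ) = β * M.disc * Phi M P B θ := by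
  have hκ := Ioc_subset_Icc_self (M.weight_mem_Ioc hβ hξ)
  have hpos := hβ.1.trans_le (M.le_one_sub_disc_mul hβ.2 hξ)
  constructor
  · rintro rfl
    rw [mul_assoc β, ASo, Theta, ← thetaStar_eq hB hκ, mul_right_comm, Model.weight,
      div_mul_cancel₀ _ hpos.ne']
  · intro h
    have hθ : M.weight β ξ * (M.disc * Phi M P B θ) = θ := by
      rw [Model.weight, div_mul_eq_mul_div, ← mul_assoc, ← h, mul_div_cancel_right₀ _ hpos.ne']
    rw [ASo, Theta, ← eq_thetaStar (θ := M.disc * Phi M P B θ) hB hκ (by rw [hθ]), hθ]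

lemma isEquilibrium_of_mem_fixedPointsG (hB : IsBrownianReal B P) (hβ : β ∈ Ioc (0 : ℝ) 1)
    (hξ : ξ ∈ fixedPointsG M P B β) : IsEquilibrium (Phi M P B) M.disc β (ASo M P B β ξ) ξ := by
  refine ⟨?_, (ASo_eq_iff hB hβ hξ.1.2).1 rfl⟩
  obtain ⟨Y, hY, rfl⟩ := hξ.2
  exact isSubgradient_of_mem_maximizers hB hY

namespace IsEquilibrium

lemma ASo_eq (h : IsEquilibrium (Phi M P B) M.disc β θ ξ) (hB : IsBrownianReal B P)
    (hβ : β ∈ Ioc (0 : ℝ) 1) : ASo M P B β ξ = θ :=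
  (ASo_eq_iff hB hβ (h.isSubgradient.le (lipschitzWith_Phi hB))).2 h.eq

lemma mem_fixedPointsG (h : IsEquilibrium (Phi M P B) M.disc β θ ξ) (hB : IsBrownianReal B P)
    (hβ : β ∈ Ioc (0 : ℝ) 1) (hθ : -1 < θ ∨ 0 < M.k) : ξ ∈ fixedPointsG M P B β := by
  obtain ⟨Y, hY, hYξ⟩ := exists_maximizer_of_isSubgradient hB h.isSubgradient hθ
  refine ⟨?_, Y, ?_, hYξ⟩
  · rw [← hYξ]
    exact ⟨integral_rpow_nonneg hY.1, integral_rpow_le_maxMoment hB hY.1⟩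
  · rw [← ASo, h.ASo_eq hB hβ]
    exact hY

end IsEquilibrium

lemma k_pos_of_AMy_neg (hB : IsBrownianReal B P) (h : AMy M P B < 0) : 0 < M.k := by
  refine M.k_nonneg.lt_of_ne fun hk => h.not_ge ?_
  have hPhi := neg_le_Phi (M := M) hB 0
  rw [← hk, zero_mul, neg_zero] at hPhi
  rw [AMy_eq]
  exact mul_nonneg M.disc_pos.le hPhi

theorem fixedPointsG_nonempty_of_AMy_neg (hB : IsBrownianReal B P) (hβ : β ∈ Ioc (0 : ℝ) 1)
    (h : AMy M P B < 0) : (fixedPointsG M P B β).Nonempty := by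
  have hPhi : Phi M P B 0 < 0 := by
    rw [AMy_eq] at h
    exact neg_of_mul_neg_right h M.disc_pos.le
  obtain ⟨θ, ξ, heq⟩ := exists_isEquilibrium_of_neg (convexOn_Phi hB) (lipschitzWith_Phi hB)
    M.disc_pos M.disc_mul_maxMoment_lt_one hβ hPhi
  exact ⟨ξ, heq.mem_fixedPointsG hB hβ (Or.inr (k_pos_of_AMy_neg hB h))⟩

theorem ASo_le_of_AMy_neg (hB : IsBrownianReal B P) (hβ₁ : β₁ ∈ Ioc (0 : ℝ) 1)
    (hβ₂ : β₂ ∈ Ioc (0 : ℝ) 1) (hβ : β₁ ≤ β₂) (h : AMy M P B < 0)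
    (hξ₁ : ξ₁ ∈ fixedPointsG M P B β₁) (hξ₂ : ξ₂ ∈ fixedPointsG M P B β₂) :
    ASo M P B β₂ ξ₂ ≤ ASo M P B β₁ ξ₁ :=
  (isEquilibrium_of_mem_fixedPointsG hB hβ₁ hξ₁).le_of_neg
    (isEquilibrium_of_mem_fixedPointsG hB hβ₂ hξ₂) (lipschitzWith_Phi hB) M.disc_pos.le
    M.disc_mul_maxMoment_lt_one hβ₁ hβ (ASo_neg hB hβ₂ hξ₂.1.2 h)

theorem exists_ASo_le_of_AMy_pos (hB : IsBrownianReal B P) (hβ₁ : β₁ ∈ Ioc (0 : ℝ) 1)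
    (hβ₂ : β₂ ∈ Ioc (0 : ℝ) 1) (hβ : β₁ ≤ β₂) (h : 0 < AMy M P B)
    (hξ₂ : ξ₂ ∈ fixedPointsG M P B β₂) :
    ∃ ξ₁ ∈ fixedPointsG M P B β₁, ASo M P B β₁ ξ₁ ≤ ASo M P B β₂ ξ₂ := by
  have hPhi : 0 < Phi M P B 0 := by
    rw [AMy_eq] at h
    exact pos_of_mul_pos_right h M.disc_pos.le
  obtain ⟨θ, ξ, heq, hθ0, hθ⟩ := (isEquilibrium_of_mem_fixedPointsG hB hβ₂ hξ₂).exists_le_of_pos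
    (convexOn_Phi hB) (lipschitzWith_Phi hB) M.disc_pos.le M.disc_mul_maxMoment_lt_one hβ₁.1.le
    hβ₂.1 hβ hPhi.le (ASo_pos hB hβ₂ hξ₂.1.2 h).le
  exact ⟨ξ, heq.mem_fixedPointsG hB hβ₁ (Or.inl (by linarith)), (heq.ASo_eq hB hβ₁).trans_le hθ⟩

end Sophisticated

end PeriodicPortfolio

theorem mainTheorem8_general {Ω : Type*} [MeasurableSpace Ω] (P : MeasureTheory.Measure Ω)
    [MeasureTheory.IsProbabilityMeasure P] [P.IsComplete] (B : NNReal → Ω → ℝ)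
    (hB : ProbabilityTheory.IsBrownianReal B P) (M : PeriodicPortfolio.Model) :
    (0 < PeriodicPortfolio.AMy M P B →
      MonotoneOn (fun β : ℝ => β * PeriodicPortfolio.AExpo M P B) (Set.Ioc 0 1) ∧
      ∀ β₁ ∈ Set.Ioc (0 : ℝ) 1, ∀ β₂ ∈ Set.Ioc (0 : ℝ) 1, β₁ ≤ β₂ →
        ∀ ξ₂ ∈ PeriodicPortfolio.fixedPointsG M P B β₂,
          ∃ ξ₁ ∈ PeriodicPortfolio.fixedPointsG M P B β₁,
          PeriodicPortfolio.ASo M P B β₁ ξ₁ ≤ PeriodicPortfolio.ASo M P B β₂ ξ₂) ∧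
    (PeriodicPortfolio.AMy M P B < 0 →
      AntitoneOn (fun β : ℝ => β * PeriodicPortfolio.AExpo M P B) (Set.Ioc 0 1) ∧
      (∀ β ∈ Set.Ioc (0 : ℝ) 1, (PeriodicPortfolio.fixedPointsG M P B β).Nonempty) ∧
      ∀ β₁ ∈ Set.Ioc (0 : ℝ) 1, ∀ β₂ ∈ Set.Ioc (0 : ℝ) 1, β₁ ≤ β₂ →
        ∀ ξ₁ ∈ PeriodicPortfolio.fixedPointsG M P B β₁,
          ∀ ξ₂ ∈ PeriodicPortfolio.fixedPointsG M P B β₂,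
          PeriodicPortfolio.ASo M P B β₂ ξ₂ ≤ PeriodicPortfolio.ASo M P B β₁ ξ₁) := by
  have h1 : (1 : ℝ) ∈ Set.Icc (0 : ℝ) 1 := ⟨zero_le_one, le_rfl⟩
  refine ⟨fun h => ⟨fun β₁ _ β₂ _ hβ => ?_, fun β₁ hβ₁ β₂ hβ₂ hβ ξ₂ hξ₂ => ?_⟩,
    fun h => ⟨fun β₁ _ β₂ _ hβ => ?_, fun β hβ => ?_, fun β₁ hβ₁ β₂ hβ₂ hβ ξ₁ hξ₁ ξ₂ hξ₂ => ?_⟩⟩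
  · exact mul_le_mul_of_nonneg_right hβ (PeriodicPortfolio.thetaStar_pos hB h1 h).le
  · exact PeriodicPortfolio.exists_ASo_le_of_AMy_pos hB hβ₁ hβ₂ hβ h hξ₂
  · exact mul_le_mul_of_nonpos_right hβ (PeriodicPortfolio.thetaStar_neg hB h1 h).le
  · exact PeriodicPortfolio.fixedPointsG_nonempty_of_AMy_neg hB hβ h
  · exact PeriodicPortfolio.ASo_le_of_AMy_neg hB hβ₁ hβ₂ hβ h hξ₁ hξ₂

theorem mainTheorem8 {Ω : Type*} [MeasurableSpace Ω] (P : MeasureTheory.Measure Ω)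
    [MeasureTheory.IsProbabilityMeasure P] [P.IsComplete] (B : NNReal → Ω → ℝ)
    (hB : ProbabilityTheory.IsBrownianReal B P) (M : PeriodicPortfolio.Model) :
    (0 < PeriodicPortfolio.AMy M P B →
      MonotoneOn (fun β : ℝ => β * PeriodicPortfolio.AExpo M P B) (Set.Ioc 0 1) ∧
      ∀ β₁ ∈ Set.Ioc (0 : ℝ) 1, ∀ β₂ ∈ Set.Ioc (0 : ℝ) 1, β₁ ≤ β₂ →
        ∀ ξ₁ ξ₂ : ℝ, PeriodicPortfolio.fixedPointsG M P B β₁ = {ξ₁} →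
          PeriodicPortfolio.fixedPointsG M P B β₂ = {ξ₂} →
          PeriodicPortfolio.ASo M P B β₁ ξ₁ ≤ PeriodicPortfolio.ASo M P B β₂ ξ₂) ∧
    (PeriodicPortfolio.AMy M P B < 0 →
      AntitoneOn (fun β : ℝ => β * PeriodicPortfolio.AExpo M P B) (Set.Ioc 0 1) ∧
      (∀ β ∈ Set.Ioc (0 : ℝ) 1, (PeriodicPortfolio.fixedPointsG M P B β).Nonempty) ∧
      ∀ β₁ ∈ Set.Ioc (0 : ℝ) 1, ∀ β₂ ∈ Set.Ioc (0 : ℝ) 1, β₁ ≤ β₂ →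
        ∀ ξ₁ ∈ PeriodicPortfolio.fixedPointsG M P B β₁,
          ∀ ξ₂ ∈ PeriodicPortfolio.fixedPointsG M P B β₂,
          PeriodicPortfolio.ASo M P B β₂ ξ₂ ≤ PeriodicPortfolio.ASo M P B β₁ ξ₁) := by
  obtain ⟨hpos, hneg⟩ := mainTheorem8_general P B hB M
  refine ⟨fun h => ⟨(hpos h).1, fun β₁ hβ₁ β₂ hβ₂ hβ ξ₁ ξ₂ hξ₁ hξ₂ => ?_⟩, hneg⟩
  simpa [hξ₁, hξ₂] using (hpos h).2 β₁ hβ₁ β₂ hβ₂ hβ
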